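/- Probabilistic zero forcing on a finite simple graph $G$: some vertices are blue, the others white. In each time step every blue vertex $u$ independently forces each white neighbour $v$ to become blue with probability $C[u]/\deg u$, where $C[u]$ is the number of blue vertices in the closed neighbourhood of $u$; blue vertices stay blue. The propagation time of a set $S$ of initially blue vertices is the first time at which all vertices are blue, and $\mathrm{ept}(G)$ is the minimum over all vertices $v$ of the expected propagation time of $\{v\}$. Let $\log$ be the natural logarithm. (1) There is an absolute constant $C>0$ such that for every $d\ge 2$ and every connected $d$-regular graph $G$ on $n$ vertices, $$\mathrm{ept}(G)\le C\, n\,\frac{\log d}{d}.$$ (2) Explicitly, there is an absolute constant $A>0$ such that for every $d\ge 3$ and every connected $d$-regular graph $G$ on $n$ vertices, $$\mathrm{ept}(G)\le 60\,\frac{\log\frac{d+1}{3}}{d+1}\,n + A\log n .$$ (3) For $m\ge 1$ let $G_{m,d}$ be the following graph on $n=m(d+1)$ vertices: take copies $C_1,\dots,C_m$ of the complete graph $K_{d+1}$, choose two distinct vertices $v_{(i,1)},v_{(i,2)}$ in each $C_i$, delete the edge between $v_{(i,1)}$ and $v_{(i,2)}$ for every $i$, and then insert an edge between $v_{(i,1)}$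 and $v_{(i+1,2)}$ for every $i$ (indices modulo $m$). There is an absolute constant $c>0$ such that for all $d\ge 3$ and $m\ge 1$ the graph $G_{m,d}$ is connected and $d$-regular and $$\mathrm{ept}(G_{m,d})\ge c\, n\,\frac{\log\log d}{d}.$$ -/

import Mathlib

open MeasureTheory Finset
open scoped ENNReal unitInterval

namespace ZeroForcing

section Forcing

variable {V : Type*} [Fintype V] [DecidableEq V] (G : SimpleGraph V) [DecidableRel G.Adj]

/-- `C[u]`: the number of blue vertices in the closed neighbourhood of `u`, when the set of blue
vertices is `B`. -/
def closedBlueCount (B : Finset V) (u : V) : ℕ :=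
  #{w ∈ B | w = u ∨ G.Adj u w}

/-- The probability `C[u] / deg u` with which a blue vertex `u` forces each of its white
neighbours in one step. (It is at most `1` as soon as `u` has a white neighbour.) -/
noncomputable def forceProb (B : Finset V) (u : V) : ℝ :=
  (closedBlueCount G B u : ℝ) / (G.degree u : ℝ)

/-- One time step from the blue set `B`. The randomness of the step is a family of numbers
`x (u, v)` in the unit interval, one for every ordered pair of vertices; the blue vertex `u`
forces its neighbour `v` when `x (u, v) ≤ C[u] / deg u`. Blue vertices stay blue. -/
noncomputable def step (x : V × V → I) (B : Finset V) : Finset V :=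
  B ∪ Finset.univ.filter fun v => ∃ u ∈ B, G.Adj u v ∧ (x (u, v) : ℝ) ≤ forceProb G B u

/-- The sample space: for every time step, one number in `[0, 1]` for every ordered pair of
vertices. -/
abbrev Sample (V : Type*) : Type _ := ℕ → V × V → I

/-- The probability measure on the sample space under which all the numbers are independent and
uniformly distributed on `[0, 1]`. -/
noncomputable def sampleMeasure (V : Type*) [Fintype V] : Measure (Sample V) :=
  Measure.infinitePi fun _ : ℕ => Measure.pi fun _ : V × V => (volume : Measure I)

/-- The set of blue vertices after `t` steps of probabilistic zero forcing started from `S`. -/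
noncomputable def blue (S : Finset V) (ω : Sample V) : ℕ → Finset V
  | 0 => S
  | t + 1 => step G (ω t) (blue S ω t)

/-- The propagation time of `S`: the first time at which all the vertices are blue, and `∞` if
there is no such time. -/
noncomputable def propTime (S : Finset V) (ω : Sample V) : ℝ≥0∞ :=
  ⨅ (t : ℕ) (_ : blue G S ω t = Finset.univ), (t : ℝ≥0∞)

/-- The expected propagation time of the set `S`. -/
noncomputable def eptFrom (S : Finset V) : ℝ≥0∞ :=
  ∫⁻ ω, propTime G S ω ∂(sampleMeasure V)

/-- The expected propagation time of the graph: the minimum over all one-vertex initial sets. -/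
noncomputable def ept : ℝ≥0∞ :=
  ⨅ v : V, eptFrom G {v}

end Forcing

section Ring

/-- `m` disjoint copies of the complete graph on `d + 1` vertices. -/
def cliques (m d : ℕ) : SimpleGraph (Fin m × Fin (d + 1)) :=
  SimpleGraph.fromRel fun x y => x.1 = y.1

/-- In every copy `i`, the edge between the designated vertices `(i, 0)` and `(i, d)`. -/
def deletedEdges (m d : ℕ) : SimpleGraph (Fin m × Fin (d + 1)) :=
  SimpleGraph.fromRel fun x y => x.1 = y.1 ∧ x.2 = 0 ∧ y.2 = Fin.last d

/-- For every `i`, the edge between `(i, 0)` and `(i + 1, d)`, with `i + 1` taken modulo `m`. -/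
def insertedEdges (m d : ℕ) [NeZero m] : SimpleGraph (Fin m × Fin (d + 1)) :=
  SimpleGraph.fromRel fun x y => y.1 = x.1 + 1 ∧ x.2 = 0 ∧ y.2 = Fin.last d

/-- The ring of `m` copies of the complete graph on `d + 1` vertices: in each copy one edge is
removed, and one of its ends is joined to the other end of the edge removed from the next copy. -/
def ringOfCliques (m d : ℕ) [NeZero m] : SimpleGraph (Fin m × Fin (d + 1)) :=
  (cliques m d \ deletedEdges m d) ⊔ insertedEdges m d

instance (m d : ℕ) : DecidableRel (cliques m d).Adj :=
  fun x y => decidable_of_iff (x ≠ y ∧ (x.1 = y.1 ∨ y.1 = x.1)) Iff.rfl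

instance (m d : ℕ) : DecidableRel (deletedEdges m d).Adj :=
  fun x y => decidable_of_iff (x ≠ y ∧ ((x.1 = y.1 ∧ x.2 = 0 ∧ y.2 = Fin.last d) ∨
    (y.1 = x.1 ∧ y.2 = 0 ∧ x.2 = Fin.last d))) Iff.rfl

instance (m d : ℕ) [NeZero m] : DecidableRel (insertedEdges m d).Adj :=
  fun x y => decidable_of_iff (x ≠ y ∧ ((y.1 = x.1 + 1 ∧ x.2 = 0 ∧ y.2 = Fin.last d) ∨
    (x.1 = y.1 + 1 ∧ y.2 = 0 ∧ x.2 = Fin.last d))) Iff.rfl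

instance (m d : ℕ) [NeZero m] : DecidableRel (ringOfCliques m d).Adj :=
  fun x y => decidable_of_iff
    (((cliques m d).Adj x y ∧ ¬ (deletedEdges m d).Adj x y) ∨ (insertedEdges m d).Adj x y) Iff.rfl

end Ring

end ZeroForcing

/-! Both bounds come from scalar potentials on blue sets whose mean change in one step is
controlled.

Upper bound. For a target `w`, assign to a blue vertex `u` the weight 2d^dist(u,w)/C[u], and take
the minimum over blue `u`. Let `u` be the minimizer and `v` its successor on a geodesic to `w`.
Either `u` forces `v`, which lowers the exponent, or the other forces out of `u` tend to enlarge
C[u]. Together these contract the potential by 3/4 in mean (`stepMean_pathPotential_le`). Since it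
is at least 1 while `w` is white, the probability that `w` is white at time t is at most (3/4)^t ·
2d^dist. A union bound over `w` and summation over t give an expected time of O(log n + D log d),
where D is the eccentricity of the start, and D + 1 ≤ 3n/(d+1) by packing closed neighbourhoods
(`succ_dist_mul_le`).

Lower bound. Layer the ring by cyclic distance from the starting clique. If the furthest layer
reached has b blue vertices, its expected count after a step is at most b² + 2b + 4, so a doubly
logarithmic function of b grows by O(1). An exit has probability only O(b/d), so skipping the rest
of the growth is rarely possible. The potential K·(layer index) + min(K, growth), with K of order
log log d, therefore has drift at most 18 (`IsLayering.stepMean_layerPotential_le`). It must climb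
from 0 to at least K(⌊m/2⌋ + 1), and `le_add_mul_eptFrom` turns this into a bound on expected time.
-/

namespace ZeroForcing

/-! ### The Markov property, and drift criteria for the expected propagation time -/

section Evolution

variable {V : Type*} [Fintype V] [DecidableEq V] (G : SimpleGraph V) [DecidableRel G.Adj]

/-- The law of the randomness of a single step. -/
noncomputable def stepMeasure (V : Type*) [Fintype V] : Measure (V × V → I) :=
  Measure.pi fun _ : V × V => (volume : Measure I)

instance : IsProbabilityMeasure (stepMeasure V) := by
  unfold stepMeasure; infer_instance

instance : IsProbabilityMeasure (sampleMeasure V) := by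
  unfold sampleMeasure; infer_instance

theorem mem_step {x : V × V → I} {B : Finset V} {v : V} :
    v ∈ step G x B ↔ v ∈ B ∨ ∃ u ∈ B, G.Adj u v ∧ (x (u, v) : ℝ) ≤ forceProb G B u := by
  simp [step]

theorem subset_step (x : V × V → I) (B : Finset V) : B ⊆ step G x B :=
  subset_union_left

@[simp] theorem step_univ (x : V × V → I) : step G x univ = univ :=
  univ_subset_iff.1 (subset_step G x univ)

theorem measurableSet_forced (B : Finset V) (u v : V) :
    MeasurableSet {x : V × V → I | (x (u, v) : ℝ) ≤ forceProb G B u} :=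
  measurableSet_le (measurable_subtype_coe.comp (measurable_pi_apply (u, v))) measurable_const

theorem measurableSet_mem_step (B : Finset V) (v : V) :
    MeasurableSet {x : V × V → I | v ∈ step G x B} := by
  have : {x : V × V → I | v ∈ step G x B} = {_x | v ∈ B} ∪
      ⋃ u, {_x | u ∈ B ∧ G.Adj u v} ∩ {x | (x (u, v) : ℝ) ≤ forceProb G B u} := by
    ext x; simp [mem_step, and_assoc]
  rw [this]
  exact (MeasurableSet.const _).union (MeasurableSet.iUnion fun u =>
    (MeasurableSet.const _).inter (measurableSet_forced G B u v))

theorem measurableSet_step_eq (B B' : Finset V) :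
    MeasurableSet {x : V × V → I | step G x B = B'} := by
  have : {x : V × V → I | step G x B = B'} = ⋂ v, {x | v ∈ step G x B ↔ v ∈ B'} := by
    ext x; simp [Finset.ext_iff]
  rw [this]
  exact MeasurableSet.iInter fun v => (measurableSet_mem_step G B v).iff (MeasurableSet.const _)

omit [DecidableEq V] in
theorem measurable_comp_of_fiber {Ω : Type*} [MeasurableSpace Ω] {X : Ω → Finset V}
    (hX : ∀ B, MeasurableSet {ω | X ω = B}) {β : Type*} [MeasurableSpace β] (F : Finset V → β) :
    Measurable fun ω => F (X ω) := by
  let _ : MeasurableSpace (Finset V) := ⊤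
  have h1 : Measurable X := measurable_to_countable' hX
  exact (measurable_from_top (f := F)).comp h1

theorem measurable_comp_step (B : Finset V) {β : Type*} [MeasurableSpace β] (F : Finset V → β) :
    Measurable fun x : V × V → I => F (step G x B) :=
  measurable_comp_of_fiber (measurableSet_step_eq G B) F

theorem measurableSet_blue_eq (S : Finset V) (t : ℕ) (B : Finset V) :
    MeasurableSet {ω : Sample V | blue G S ω t = B} := by
  induction t generalizing B with
  | zero => exact MeasurableSet.const (S = B)
  | succ t ih =>
    have : {ω : Sample V | blue G S ω (t + 1) = B} =
        ⋃ A, {ω | blue G S ω t = A} ∩ {ω | step G (ω t) A = B} := by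
      ext ω; simp [blue]
    rw [this]
    exact MeasurableSet.iUnion fun A => (ih A).inter
      (measurableSet_step_eq G A B |>.preimage (measurable_pi_apply t))

theorem measurable_comp_blue (S : Finset V) (t : ℕ) {β : Type*} [MeasurableSpace β]
    (F : Finset V → β) : Measurable fun ω : Sample V => F (blue G S ω t) :=
  measurable_comp_of_fiber (measurableSet_blue_eq G S t) F

theorem blue_congr (S : Finset V) {ω ω' : Sample V} {t : ℕ} (h : ∀ s < t, ω s = ω' s) :
    blue G S ω t = blue G S ω' t := by
  induction t with
  | zero => rfl
  | succ t ih =>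
    simp only [blue]
    rw [ih fun s hs => h s (by omega), h t (by omega)]

theorem blue_mono (S : Finset V) (ω : Sample V) : Monotone (blue G S ω) :=
  monotone_nat_of_le_succ fun _ => subset_step G _ _

/-- The expectation of `F` after one step from `B`. -/
noncomputable def stepMean (F : Finset V → ℝ≥0∞) (B : Finset V) : ℝ≥0∞ :=
  ∫⁻ x, F (step G x B) ∂(stepMeasure V)

/-- The state at time t is a function of the coordinates before t, and these are independent of
coordinate t. -/
theorem indepFun_blue (S : Finset V) (t : ℕ) (f : Finset V → ℝ≥0∞) {g : (V × V → I) → ℝ≥0∞}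
    (hg : Measurable g) :
    ProbabilityTheory.IndepFun (fun ω : Sample V => f (blue G S ω t)) (fun ω => g (ω t))
      (sampleMeasure V) := by
  have h0 : ProbabilityTheory.iIndepFun (fun (i : ℕ) (ω : Sample V) => ω i) (sampleMeasure V) :=
    ProbabilityTheory.iIndepFun_infinitePi (Ω := fun _ => V × V → I)
      (P := fun _ => stepMeasure V) (X := fun _ x => x) (fun _ => measurable_id)
  have h1 := h0.indepFun_finset (Finset.range t) {t} (by simp) (fun i => measurable_pi_apply i)
  -- A finite history is padded by zeros to a full sample; by `blue_congr` the padding does not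
  -- affect the state at time t.
  let ext : (↥(Finset.range t) → V × V → I) → Sample V :=
    fun y s => if h : s ∈ Finset.range t then y ⟨s, h⟩ else fun _ => 0
  have hext : Measurable ext := by
    refine measurable_pi_lambda _ fun s => ?_
    by_cases h : s ∈ Finset.range t
    · simp only [ext, h, dite_true]; exact measurable_pi_apply _
    · simp only [ext, h, dite_false]; exact measurable_const
  have h2 := ProbabilityTheory.IndepFun.comp h1 (φ := fun y => f (blue G S (ext y) t))
    (ψ := fun y : (↥({t} : Finset ℕ) → V × V → I) => g (y ⟨t, by simp⟩))
    ((measurable_comp_blue G S t f).comp hext) (hg.comp (measurable_pi_apply _))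
  convert h2 using 1
  · funext ω
    simp only [Function.comp]
    congr 1
    apply blue_congr
    intro s hs
    simp [ext, hs]
  · rfl

omit [DecidableEq V] in
theorem lintegral_eval (t : ℕ) {g : (V × V → I) → ℝ≥0∞} (hg : Measurable g) :
    ∫⁻ ω, g (ω t) ∂(sampleMeasure V) = ∫⁻ x, g x ∂(stepMeasure V) :=
  (measurePreserving_eval_infinitePi (fun _ : ℕ => stepMeasure V) t).lintegral_comp hg

theorem lintegral_blue_succ (S : Finset V) (F : Finset V → ℝ≥0∞) (t : ℕ) :
    ∫⁻ ω, F (blue G S ω (t + 1)) ∂(sampleMeasure V) =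
      ∫⁻ ω, stepMean G F (blue G S ω t) ∂(sampleMeasure V) := by
  -- Indicators of the finitely many possible states: independence is applied with the present state
  -- frozen at each `B`.
  let e : Finset V → Finset V → ℝ≥0∞ := fun B A => if A = B then 1 else 0
  have h1 : ∀ ω : Sample V, F (blue G S ω (t + 1)) =
      ∑ B, e B (blue G S ω t) * F (step G (ω t) B) := by
    intro ω; simp [e, blue]
  have h2 : ∀ ω : Sample V, stepMean G F (blue G S ω t) =
      ∑ B, e B (blue G S ω t) * stepMean G F B := by
    intro ω; simp [e]
  simp only [h1, h2]
  have hm : ∀ B, Measurable fun ω : Sample V => F (step G (ω t) B) := fun B =>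
    (measurable_comp_step G B F).comp (measurable_pi_apply t)
  rw [lintegral_finsetSum, lintegral_finsetSum]
  rotate_left
  · exact fun B _ => (measurable_comp_blue G S t (e B)).mul measurable_const
  · exact fun B _ => (measurable_comp_blue G S t (e B)).mul (hm B)
  refine Finset.sum_congr rfl fun B _ => ?_
  rw [lintegral_mul_const _ (measurable_comp_blue G S t (e B))]
  have := ProbabilityTheory.lintegral_mul_eq_lintegral_mul_lintegral_of_indepFun
    (measurable_comp_blue G S t (e B)) (hm B)
    (indepFun_blue G S t (e B) (measurable_comp_step G B F))
  simp only [Pi.mul_apply] at this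
  rw [this, lintegral_eval t (measurable_comp_step G B F)]
  rfl

/-- Blue sets only grow, so the hitting time counts the times at which the process is unfinished.
Integrating gives the tail-sum formula for the expectation. -/
theorem propTime_eq_tsum (S : Finset V) (ω : Sample V) :
    propTime G S ω = ∑' t : ℕ, if blue G S ω t = univ then 0 else 1 := by
  classical
  unfold propTime
  by_cases h : ∃ t, blue G S ω t = univ
  · have hlt : ∀ t, blue G S ω t = univ ↔ Nat.find h ≤ t := fun t =>
      ⟨fun ht => Nat.find_min' h ht, fun ht =>
        univ_subset_iff.1 ((Nat.find_spec h).symm.subset.trans (blue_mono G S ω ht))⟩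
    have hs : ∑' t : ℕ, (if blue G S ω t = univ then (0 : ℝ≥0∞) else 1) = Nat.find h := by
      rw [tsum_eq_sum (s := range (Nat.find h))]
      · rw [Finset.sum_congr rfl (g := fun _ => (1 : ℝ≥0∞))]
        · simp
        · intro t ht
          rw [if_neg]
          rw [hlt]; simpa using ht
      · intro t ht
        rw [if_pos]
        rw [hlt]; simpa using ht
    rw [hs]
    refine le_antisymm (iInf₂_le (Nat.find h) (Nat.find_spec h)) (le_iInf₂ fun t ht => ?_)
    exact_mod_cast (hlt t).1 ht
  · push Not at h
    simp [h]

theorem eptFrom_eq_tsum (S : Finset V) :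
    eptFrom G S = ∑' t : ℕ, sampleMeasure V {ω | blue G S ω t ≠ univ} := by
  unfold eptFrom
  simp only [propTime_eq_tsum]
  rw [lintegral_tsum fun t =>
    (measurable_comp_blue G S t fun B => if B = univ then (0 : ℝ≥0∞) else 1).aemeasurable]
  congr 1
  funext t
  have hm : MeasurableSet {ω : Sample V | blue G S ω t ≠ univ} :=
    (measurableSet_blue_eq G S t univ).compl
  rw [← lintegral_indicator_one hm]
  refine lintegral_congr fun ω => ?_
  by_cases h : blue G S ω t = univ <;> simp [h]

/-- A function that contracts in mean under a step decays exponentially along the process. -/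
theorem lintegral_blue_le_pow (S : Finset V) {F : Finset V → ℝ≥0∞} {r : ℝ≥0∞}
    (hF : ∀ B, S ⊆ B → stepMean G F B ≤ r * F B) (t : ℕ) :
    ∫⁻ ω, F (blue G S ω t) ∂(sampleMeasure V) ≤ r ^ t * F S := by
  induction t with
  | zero => simp [blue]
  | succ t ih =>
    rw [lintegral_blue_succ]
    calc _ ≤ ∫⁻ ω, r * F (blue G S ω t) ∂(sampleMeasure V) :=
          lintegral_mono fun ω => hF _ (blue_mono G S ω (Nat.zero_le t))
      _ = r * ∫⁻ ω, F (blue G S ω t) ∂(sampleMeasure V) :=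
          lintegral_const_mul _ (measurable_comp_blue G S t F)
      _ ≤ r * (r ^ t * F S) := by gcongr
      _ = _ := by rw [pow_succ']; ring

/-- A function whose mean increases by at most `D` in a step certifies a lower bound for the
expected propagation time. -/
theorem le_add_mul_eptFrom (S : Finset V) {F : Finset V → ℝ≥0∞} {D : ℝ≥0∞} (hD : D ≠ 0)
    (hF : ∀ B, S ⊆ B → B ≠ univ → stepMean G F B ≤ F B + D) :
    F univ ≤ F S + D * eptFrom G S := by
  by_cases htop : eptFrom G S = ∞
  · simp [htop, ENNReal.mul_top hD]
  set a : ℕ → ℝ≥0∞ := fun t => sampleMeasure V {ω | blue G S ω t ≠ univ} with ha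
  have hm : ∀ t, MeasurableSet {ω : Sample V | blue G S ω t ≠ univ} := fun t =>
    (measurableSet_blue_eq G S t univ).compl
  -- A finite expectation is a convergent tail sum, so the process finishes almost surely; hence the
  -- mean of `F` is eventually almost at least `F univ`.
  have hlim : Filter.Tendsto a Filter.atTop (nhds 0) :=
    ENNReal.tendsto_atTop_zero_of_tsum_ne_top (by rwa [← eptFrom_eq_tsum])
  have hup : ∀ t, ∫⁻ ω, F (blue G S ω t) ∂(sampleMeasure V) ≤
      F S + D * ∑ s ∈ Finset.range t, a s := by
    intro t
    induction t with
    | zero => simp [blue]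
    | succ t ih =>
      rw [lintegral_blue_succ, Finset.sum_range_succ, mul_add, ← add_assoc]
      have hpt : ∀ ω : Sample V, stepMean G F (blue G S ω t) ≤ F (blue G S ω t) +
          D * {ω | blue G S ω t ≠ univ}.indicator 1 ω := by
        intro ω
        by_cases h : blue G S ω t = univ
        · simp [h, stepMean]
        · simpa [h] using hF _ (blue_mono G S ω (Nat.zero_le t)) h
      refine (lintegral_mono hpt).trans ?_
      rw [lintegral_add_left (measurable_comp_blue G S t F),
        lintegral_const_mul _ (measurable_one.indicator (hm t)), lintegral_indicator_one (hm t)]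
      gcongr
  have hlow : ∀ t, F univ * (1 - a t) ≤ F S + D * eptFrom G S := by
    intro t
    have h1 : F univ * (1 - a t) ≤ ∫⁻ ω, F (blue G S ω t) ∂(sampleMeasure V) := by
      have hc : 1 - a t = sampleMeasure V {ω | blue G S ω t ≠ univ}ᶜ :=
        (prob_compl_eq_one_sub (hm t)).symm
      rw [hc, ← lintegral_indicator_one (hm t).compl,
        ← lintegral_const_mul _ (measurable_one.indicator (hm t).compl)]
      refine lintegral_mono fun ω => ?_
      by_cases h : blue G S ω t = univ <;> simp [h]
    refine h1.trans ((hup t).trans ?_)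
    rw [eptFrom_eq_tsum]
    gcongr
    exact ENNReal.sum_le_tsum _
  have h2 : Filter.Tendsto (fun t => F univ * (1 - a t)) Filter.atTop (nhds (F univ * (1 - 0))) :=
    ENNReal.Tendsto.const_mul (ENNReal.Tendsto.sub tendsto_const_nhds hlim (by simp)) (by simp)
  simpa using le_of_tendsto' h2 hlow

end Evolution

/-! ### A single step: independent edges and growth of the closed blue count -/

section Step

variable {V : Type*} [Fintype V]

theorem lintegral_unitInterval_ite {q : ℝ} (h0 : 0 ≤ q) (h1 : q ≤ 1) (a b : ℝ≥0∞) :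
    ∫⁻ y : I, (if (y : ℝ) ≤ q then a else b) =
      a * ENNReal.ofReal q + b * ENNReal.ofReal (1 - q) := by
  have hm : MeasurableSet (Set.Iic (⟨q, h0, h1⟩ : I)) := measurableSet_Iic
  have h : ∀ y : I, (if (y : ℝ) ≤ q then a else b) =
      (Set.Iic (⟨q, h0, h1⟩ : I)).indicator (fun _ => a) y +
        (Set.Iic (⟨q, h0, h1⟩ : I))ᶜ.indicator (fun _ => b) y := by
    intro y
    have hy : (y ∈ Set.Iic (⟨q, h0, h1⟩ : I)) ↔ (y : ℝ) ≤ q := Iff.rfl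
    by_cases hq : (y : ℝ) ≤ q
    · rw [Set.indicator_of_mem (hy.2 hq), Set.indicator_of_notMem (by simpa using hy.2 hq)]
      simp [hq]
    · rw [Set.indicator_of_notMem (mt hy.1 hq), Set.indicator_of_mem (mt hy.1 hq)]
      simp [hq]
  simp only [h]
  rw [lintegral_add_left (measurable_const.indicator hm), lintegral_indicator_const hm,
    lintegral_indicator_const hm.compl, Set.compl_Iic, unitInterval.volume_Iic,
    unitInterval.volume_Ioi]

theorem stepMeasure_forced_le (q : ℝ) (i : V × V) :
    stepMeasure V {x | (x i : ℝ) ≤ q} ≤ ENNReal.ofReal q := by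
  rcases le_or_gt q 1 with h1 | h1
  · rcases le_or_gt 0 q with h0 | h0
    · have hm : MeasurableSet {y : I | (y : ℝ) ≤ q} :=
        measurableSet_le measurable_subtype_coe measurable_const
      have := (measurePreserving_eval (fun _ : V × V => (volume : Measure I)) i).measure_preimage
        hm.nullMeasurableSet
      have h2 : volume {y : I | (y : ℝ) ≤ q} = ENNReal.ofReal q :=
        unitInterval.volume_Iic (x := ⟨q, h0, h1⟩)
      rw [← h2, ← this]
      rfl
    · have : {x : V × V → I | (x i : ℝ) ≤ q} = ∅ := by
        ext x
        simpa using h0.trans_le (x i).2.1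
      simp [this]
  · exact prob_le_one.trans (by simpa using h1.le)

theorem lintegral_stepMeasure_prod (u : V) (s : Finset V) {f : V → I → ℝ≥0∞}
    (hf : ∀ y, Measurable (f y)) :
    ∫⁻ x, ∏ y ∈ s, f y (x (u, y)) ∂(stepMeasure V) = ∏ y ∈ s, ∫⁻ z, f y z := by
  have h0 : ProbabilityTheory.iIndepFun (fun (i : V × V) (x : V × V → I) => f i.2 (x i))
      (stepMeasure V) :=
    ProbabilityTheory.iIndepFun_pi (μ := fun _ : V × V => (volume : Measure I))
      (X := fun i => f i.2) fun i => (hf i.2).aemeasurable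
  have h1 := h0.precomp (g := fun y : V => (u, y)) fun a b h => by simpa using h
  refine (ProbabilityTheory.lintegral_prod_eq_prod_lintegral_of_indepFun s
    (fun y (x : V × V → I) => f y (x (u, y))) h1
      fun y => (hf y).comp (measurable_pi_apply (u, y))).trans ?_
  refine Finset.prod_congr rfl fun y _ => ?_
  exact (measurePreserving_eval (fun _ : V × V => (volume : Measure I)) (u, y)).lintegral_comp
    (hf y)

variable [DecidableEq V] (G : SimpleGraph V) [DecidableRel G.Adj]

theorem closedBlueCount_of_mem {B : Finset V} {u : V} (hu : u ∈ B) :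
    closedBlueCount G B u = #(B ∩ G.neighborFinset u) + 1 := by
  unfold closedBlueCount
  rw [← Finset.card_insert_of_notMem (a := u) (s := B ∩ G.neighborFinset u) (by simp)]
  congr 1
  ext w
  simp only [mem_filter, mem_insert, mem_inter, SimpleGraph.mem_neighborFinset]
  constructor
  · tauto
  · rintro (rfl | h) <;> tauto

theorem closedBlueCount_le (B : Finset V) (u : V) : closedBlueCount G B u ≤ G.degree u + 1 := by
  unfold closedBlueCount
  rw [← G.card_neighborFinset_eq_degree,
    ← Finset.card_insert_of_notMem (a := u) (s := G.neighborFinset u) (by simp)]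
  refine card_le_card fun w => ?_
  simp

/-- The vertex `u` itself, counted in C[u], takes the place of the removed white neighbour `v`. In
particular C[u] ≤ deg u whenever `u` has a white neighbour. -/
theorem closedBlueCount_add_card_white {B : Finset V} {u v : V} (hu : u ∈ B) (hv : v ∉ B)
    (huv : G.Adj u v) :
    closedBlueCount G B u + #((G.neighborFinset u \ B).erase v) = G.degree u := by
  have h1 := closedBlueCount_of_mem G hu
  have h2 := card_erase_add_one (s := G.neighborFinset u \ B) (a := v) (by simp [huv, hv])
  have h3 := card_sdiff_add_card_inter (G.neighborFinset u) B
  rw [inter_comm, G.card_neighborFinset_eq_degree] at h3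
  omega

/-- Only forces by `u` itself are counted, and `v` is left out, so that this growth is independent
of whether `u` forces `v`. -/
theorem closedBlueCount_step_ge {B : Finset V} {u : V} (v : V) (hu : u ∈ B) (x : V × V → I) :
    closedBlueCount G B u +
      #{y ∈ (G.neighborFinset u \ B).erase v | (x (u, y) : ℝ) ≤ forceProb G B u} ≤
      closedBlueCount G (step G x B) u := by
  rw [closedBlueCount_of_mem G hu, closedBlueCount_of_mem G (subset_step G x B hu)]
  rw [add_right_comm, ← card_union_of_disjoint]
  · gcongr
    intro y
    simp only [mem_union, mem_inter, mem_filter, mem_erase, mem_sdiff,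
      SimpleGraph.mem_neighborFinset, mem_step]
    rintro (h | h)
    · tauto
    · exact ⟨Or.inr ⟨u, hu, h.1.2.1, h.2⟩, h.1.2.1⟩
  · rw [disjoint_left]
    simp only [mem_inter, mem_filter, mem_erase, mem_sdiff]
    tauto

end Step

/-! ### The contracting potential towards a target vertex -/

section Potential

/-- Replaces a reciprocal of c + k by a power with exponent k, whose mean factorizes over
independent edges. For k ≥ c the left side is at most 1; for k ≤ c Bernoulli's inequality suffices.
-/
theorem two_mul_div_add_le {c : ℕ} (hc : 1 ≤ c) (k : ℕ) :
    2 * (c : ℝ) / (c + k) ≤ 1 + (1 - 1 / (c : ℝ)) ^ k := by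
  have hc' : (1 : ℝ) ≤ c := by exact_mod_cast hc
  have hc0 : (0 : ℝ) < c := by linarith
  have hq : 0 ≤ 1 - 1 / (c : ℝ) := by
    rw [sub_nonneg, div_le_one hc0]; exact hc'
  rw [div_le_iff₀ (by positivity)]
  have h0 := pow_nonneg hq k
  have hk : (0 : ℝ) ≤ k := by positivity
  rcases le_total (c : ℝ) k with h | h
  · nlinarith [mul_nonneg h0 (add_nonneg hc0.le hk)]
  · have hb : 1 - (k : ℝ) / c ≤ (1 - 1 / (c : ℝ)) ^ k := by
      have := one_add_mul_le_pow (a := -(1 / (c : ℝ))) (by linarith) k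
      calc 1 - (k : ℝ) / c = 1 + k * -(1 / (c : ℝ)) := by ring
        _ ≤ _ := this
        _ = _ := by ring
    have h1 : 2 * (c : ℝ) ≤ (1 + (1 - (k : ℝ) / c)) * (c + k) := by
      have : (1 + (1 - (k : ℝ) / c)) * (c + k) = 2 * c + k * (1 - k / c) := by
        field_simp; ring
      rw [this]
      have : (k : ℝ) / c ≤ 1 := (div_le_one hc0).2 h
      nlinarith
    refine h1.trans ?_
    gcongr

theorem contraction_bound {c d N : ℕ} (hd : 2 ≤ d) (hc : 1 ≤ c) (h : c + N = d) :
    (c / d : ℝ) * (c / d) + (1 - c / d) + (1 - c / d) * (1 - 1 / (d : ℝ)) ^ N ≤ 3 / 2 := by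
  have hd' : (2 : ℝ) ≤ d := by exact_mod_cast hd
  set s : ℝ := N / d with hs
  have hp : (c / d : ℝ) = 1 - s := by
    rw [hs, ← h]; push_cast
    have : (c : ℝ) + N ≠ 0 := by
      have : (1 : ℝ) ≤ c := by exact_mod_cast hc
      positivity
    field_simp; ring
  have hs0 : 0 ≤ s := by positivity
  have hs1 : s ≤ 1 := by
    have : (0 : ℝ) ≤ c / d := by positivity
    linarith
  have hq : 0 ≤ 1 - 1 / (d : ℝ) := by
    rw [sub_nonneg, div_le_one (by linarith)]; linarith
  -- Multiply by (1 + 1/d)^N, which is at least 1 + s by Bernoulli; the product is (1 - 1/d²)^N ≤ 1.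
  have hpow : (1 - 1 / (d : ℝ)) ^ N ≤ 1 / (1 + s) := by
    rw [le_div_iff₀ (by linarith)]
    have h1 : 1 + s ≤ (1 + 1 / (d : ℝ)) ^ N := by
      have := one_add_mul_le_pow (a := 1 / (d : ℝ)) (by
        have : 0 ≤ 1 / (d : ℝ) := by positivity
        linarith) N
      rw [hs]
      calc _ = 1 + (N : ℝ) * (1 / d) := by ring
        _ ≤ _ := this
    calc _ ≤ (1 - 1 / (d : ℝ)) ^ N * (1 + 1 / (d : ℝ)) ^ N := by gcongr
      _ = (1 - 1 / (d : ℝ) ^ 2) ^ N := by rw [← mul_pow]; ring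
      _ ≤ 1 := by
        apply pow_le_one₀
        · rw [sub_nonneg, div_le_one (by positivity)]; nlinarith
        · have : 0 ≤ 1 / (d : ℝ) ^ 2 := by positivity
          linarith
  rw [hp]
  have h2 : (1 - (1 - s)) * (1 - 1 / (d : ℝ)) ^ N ≤ s * (1 / (1 + s)) := by
    rw [sub_sub_cancel]; gcongr
  have h3 : s * (1 / (1 + s)) ≤ 3 / 2 - ((1 - s) * (1 - s) + (1 - (1 - s))) := by
    rw [mul_one_div, div_le_iff₀ (by linarith)]
    have : s ^ 3 ≤ s := by 
      nlinarith [mul_nonneg hs0 (sub_nonneg.2 hs1), mul_nonneg (mul_nonneg hs0 hs0) (sub_nonneg.2 hs1)]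
    nlinarith
  linarith

variable {V : Type*} [Fintype V] [DecidableEq V] (G : SimpleGraph V) [DecidableRel G.Adj]

/-- The weight of the blue vertex `u` in the potential of the target `w`, in a `d`-regular graph. -/
noncomputable def pathWeight (d : ℕ) (w : V) (B : Finset V) (u : V) : ℝ :=
  2 * (d : ℝ) ^ G.dist u w / closedBlueCount G B u

/-- A potential that contracts in mean under a step, and is at least `1` while `w` is white. -/
noncomputable def pathPotential (d : ℕ) (w : V) (B : Finset V) : ℝ≥0∞ :=
  if w ∈ B then 0 else ⨅ u ∈ B, ENNReal.ofReal (pathWeight G d w B u)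

omit [Fintype V] in
theorem pathPotential_le {d : ℕ} {w u : V} {B : Finset V} (hu : u ∈ B) :
    pathPotential G d w B ≤ ENNReal.ofReal (pathWeight G d w B u) := by
  unfold pathPotential
  split_ifs
  · simp
  · exact iInf₂_le u hu

/-- Every blue `u` has distance at least 1 to the white `w` and C[u] ≤ d + 1, so its weight is at
least 2d/(d+1) ≥ 1. The factor 2 in the weight is what makes this work. -/
theorem one_le_pathPotential (hG : G.Connected) {d : ℕ} (hd : 2 ≤ d)
    (hreg : G.IsRegularOfDegree d) {w : V} {B : Finset V} (hw : w ∉ B) :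
    1 ≤ pathPotential G d w B := by
  unfold pathPotential
  rw [if_neg hw]
  refine le_iInf₂ fun u hu => ?_
  rw [ENNReal.one_le_ofReal, pathWeight]
  have h1 : closedBlueCount G B u ≤ d + 1 := hreg.degree_eq u ▸ closedBlueCount_le G B u
  have h2 := closedBlueCount_of_mem G hu
  have h3 : (closedBlueCount G B u : ℝ) ≤ d + 1 := by exact_mod_cast h1
  have h4 : (0 : ℝ) < closedBlueCount G B u := by rw [h2]; positivity
  have hd' : (2 : ℝ) ≤ d := by exact_mod_cast hd
  have h5 : (d : ℝ) ≤ (d : ℝ) ^ G.dist u w := by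
    refine le_self_pow₀ (by linarith) ?_
    have := hG.pos_dist_of_ne (u := u) (v := w) (by rintro rfl; exact hw hu)
    omega
  rw [le_div_iff₀ h4]
  linarith

theorem two_le_closedBlueCount {B : Finset V} {u v : V} (hu : u ∈ B) (hv : v ∈ B)
    (huv : G.Adj u v) : 2 ≤ closedBlueCount G B v := by
  rw [closedBlueCount_of_mem G hv]
  have : 0 < #(B ∩ G.neighborFinset v) := card_pos.2 ⟨u, by simp [hu, huv.symm]⟩
  omega

omit [Fintype V] [DecidableEq V] [DecidableRel G.Adj] in
theorem exists_adj_dist (hG : G.Connected) {u w : V} (h : u ≠ w) :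
    ∃ v, G.Adj u v ∧ G.dist u w = G.dist v w + 1 := by
  obtain ⟨p, hp⟩ := hG.exists_walk_length_eq_dist u w
  cases p with
  | nil => exact absurd rfl h
  | @cons _ v _ huv q =>
    refine ⟨v, huv, ?_⟩
    have h1 := SimpleGraph.dist_le q
    have h2 := hG.dist_triangle (u := u) (v := v) (w := w)
    rw [SimpleGraph.dist_eq_one_iff_adj.2 huv] at h2
    simp only [SimpleGraph.Walk.length_cons] at hp
    omega

theorem stepMean_pathPotential_le (hG : G.Connected) {d : ℕ} (hd : 2 ≤ d)
    (hreg : G.IsRegularOfDegree d) (w : V) {B : Finset V} (hB : B.Nonempty) :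
    stepMean G (pathPotential G d w) B ≤ ENNReal.ofReal (3 / 4) * pathPotential G d w B := by
  by_cases hw : w ∈ B
  · have : ∀ x, pathPotential G d w (step G x B) = 0 := fun x => by
      simp [pathPotential, subset_step G x B hw]
    simp [stepMean, this]
  have hd' : (2 : ℝ) ≤ d := by exact_mod_cast hd
  obtain ⟨u, hu, hmin⟩ := exists_min_image B (pathWeight G d w B) hB
  have hval : pathPotential G d w B = ENNReal.ofReal (pathWeight G d w B u) := by
    refine le_antisymm (pathPotential_le G hu) ?_
    rw [pathPotential, if_neg hw]
    exact le_iInf₂ fun y hy => ENNReal.ofReal_le_ofReal (hmin y hy)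
  have huw : u ≠ w := by rintro rfl; exact hw hu
  obtain ⟨v, huv, hdist⟩ := exists_adj_dist G hG huw
  set D := G.dist v w with hD
  set c := closedBlueCount G B u with hc
  have hc1 : 1 ≤ c := by rw [hc, closedBlueCount_of_mem G hu]; omega
  have hc1' : (1 : ℝ) ≤ c := by exact_mod_cast hc1
  -- Once blue, `v` sees both itself and `u`, and the resulting count of at least 2 cancels the
  -- factor 2.
  have near : ∀ B' : Finset V, u ∈ B' → v ∈ B' → pathWeight G d w B' v ≤ (d : ℝ) ^ D := by
    intro B' h1 h2
    have h3 : (2 : ℝ) ≤ closedBlueCount G B' v := by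
      exact_mod_cast two_le_closedBlueCount G h1 h2 huv
    rw [pathWeight, ← hD, div_le_iff₀ (by linarith)]
    nlinarith [pow_pos (show (0 : ℝ) < d by linarith) D]
  -- If `v` were blue, its weight d^D would undercut the weight of `u`, which is at least d^D ·
  -- 2d/(d+1), against minimality.
  have hv : v ∉ B := by
    intro hv
    have h1 := (hmin v hv).trans (near B hu hv)
    rw [pathWeight, hdist, ← hc, div_le_iff₀ (by linarith)] at h1
    have h2 : c ≤ d + 1 := hreg.degree_eq u ▸ closedBlueCount_le G B u
    have h3 : (c : ℝ) ≤ d + 1 := by exact_mod_cast h2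
    have h4 := pow_pos (show (0 : ℝ) < d by linarith) D
    rw [pow_succ] at h1
    nlinarith
  set W := (G.neighborFinset u \ B).erase v with hW
  have hcard : c + #W = d := by
    rw [← hreg.degree_eq u]; exact closedBlueCount_add_card_white G hu hv huv
  set p : ℝ := forceProb G B u with hp
  have hp' : p = c / d := by rw [hp, forceProb, hreg.degree_eq u]
  have hp0 : 0 ≤ p := by rw [hp']; positivity
  have hp1 : p ≤ 1 := by
    rw [hp', div_le_one (by linarith)]; exact_mod_cast (by omega : c ≤ d)
  -- Half of the current potential, so the target factor 3/4 becomes 3/2 in terms of `b`.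
  set b : ℝ := (d : ℝ) ^ (D + 1) / c with hb
  have hb0 : 0 ≤ b := by positivity
  have hbp : (d : ℝ) ^ D = b * p := by
    rw [hb, hp', pow_succ]; field_simp
  set q : ℝ := 1 - 1 / (c : ℝ) with hq
  have hq0 : 0 ≤ q := by
    rw [hq, sub_nonneg, div_le_one (by linarith)]; exact hc1'
  let f : I → ℝ≥0∞ := fun z => if (z : ℝ) ≤ p then ENNReal.ofReal q else 1
  let g : I → ℝ≥0∞ := fun z => if (z : ℝ) ≤ p then 0 else 1
  let g' : I → ℝ≥0∞ := fun z => if (z : ℝ) ≤ p then 1 else 0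
  have hms : MeasurableSet {z : I | (z : ℝ) ≤ p} :=
    measurableSet_le measurable_subtype_coe measurable_const
  have hf : Measurable f := Measurable.ite hms measurable_const measurable_const
  have hg : Measurable g := Measurable.ite hms measurable_const measurable_const
  have hg' : Measurable g' := Measurable.ite hms measurable_const measurable_const
  have hvW : v ∉ W := by simp [hW]
  -- If `v` is forced, its new weight is at most b·p. Otherwise, with k forces into `W`, the new
  -- weight of `u` is at most b·2c/(c+k) ≤ b(1 + q^k); the product encodes q^k on the event that `v`
  -- is not forced.
  have hpt : ∀ x : V × V → I, pathPotential G d w (step G x B) ≤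
      ENNReal.ofReal (b * p) * g' (x (u, v)) + ENNReal.ofReal b * g (x (u, v)) +
        ENNReal.ofReal b * ∏ y ∈ insert v W, (if y = v then g else f) (x (u, y)) := by
    intro x
    rw [prod_insert hvW]
    have hprod : ∏ y ∈ W, (if y = v then g else f) (x (u, y)) =
        ENNReal.ofReal (q ^ #{y ∈ W | (x (u, y) : ℝ) ≤ p}) := by
      rw [ENNReal.ofReal_pow hq0, ← prod_const, prod_filter]
      refine Finset.prod_congr rfl fun y hy => ?_
      rw [if_neg (by rintro rfl; exact hvW hy)]
    rw [hprod, if_pos rfl]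
    have huS := subset_step G x B hu
    by_cases hx : (x (u, v) : ℝ) ≤ p
    · have hvS : v ∈ step G x B := (mem_step G).2 (Or.inr ⟨u, hu, huv, hx⟩)
      refine (pathPotential_le G hvS).trans ?_
      simp only [g, g', hx, if_true, mul_one, mul_zero, add_zero, zero_mul]
      rw [← hbp]
      exact ENNReal.ofReal_le_ofReal (near _ huS hvS)
    · refine (pathPotential_le G huS).trans ?_
      simp only [g, g', hx, if_false, mul_one, mul_zero, zero_add, one_mul]
      rw [← ENNReal.ofReal_mul hb0, ← ENNReal.ofReal_add hb0 (by positivity)]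
      refine ENNReal.ofReal_le_ofReal ?_
      have h1 := closedBlueCount_step_ge G v hu x
      rw [← hW, ← hp, ← hc] at h1
      set k := #{y ∈ W | (x (u, y) : ℝ) ≤ p}
      have h2 : (c : ℝ) + k ≤ closedBlueCount G (step G x B) u := by exact_mod_cast h1
      rw [pathWeight, hdist]
      calc 2 * (d : ℝ) ^ (D + 1) / closedBlueCount G (step G x B) u
          ≤ 2 * (d : ℝ) ^ (D + 1) / (c + k) := by gcongr
        _ = b * (2 * c / (c + k)) := by rw [hb]; field_simp
        _ ≤ b * (1 + q ^ k) := by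
          gcongr; exact two_mul_div_add_le hc1 k
        _ = _ := by ring
  refine (lintegral_mono hpt).trans ?_
  have e1 : Measurable fun x : V × V → I => g' (x (u, v)) := hg'.comp (measurable_pi_apply _)
  have e2 : Measurable fun x : V × V → I => g (x (u, v)) := hg.comp (measurable_pi_apply _)
  have hfg : ∀ y, Measurable (if y = v then g else f) := fun y => by split_ifs <;> assumption
  have e3 : Measurable fun x : V × V → I =>
      ∏ y ∈ insert v W, (if y = v then g else f) (x (u, y)) :=
    Finset.measurable_fun_prod _ fun y _ => (hfg y).comp (measurable_pi_apply _)
  rw [lintegral_add_right _ (e3.const_mul _),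
    lintegral_add_left (e1.const_mul _), lintegral_const_mul _ e1, lintegral_const_mul _ e2,
    lintegral_const_mul _ e3, lintegral_stepMeasure_prod u (insert v W) hfg, prod_insert hvW]
  have i0 : ∀ {h : I → ℝ≥0∞}, Measurable h →
      ∫⁻ x, h (x (u, v)) ∂(stepMeasure V) = ∫⁻ z, h z := fun {h} hh =>
    (measurePreserving_eval (fun _ : V × V => (volume : Measure I)) (u, v)).lintegral_comp hh
  have ig' : ∫⁻ z, g' z = ENNReal.ofReal p := by
    simp only [g']; rw [lintegral_unitInterval_ite hp0 hp1]; simp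
  have ig : ∫⁻ z, g z = ENNReal.ofReal (1 - p) := by
    simp only [g]; rw [lintegral_unitInterval_ite hp0 hp1]; simp
  -- The mean is p(1 - 1/c) + (1 - p) = 1 - p/c, and p = c/d makes it independent of c.
  have if' : ∫⁻ z, f z = ENNReal.ofReal (1 - 1 / (d : ℝ)) := by
    simp only [f]
    rw [lintegral_unitInterval_ite hp0 hp1, one_mul, ← ENNReal.ofReal_mul hq0,
      ← ENNReal.ofReal_add (by positivity) (by linarith)]
    congr 1
    rw [hq, hp']; field_simp; ring
  have hd0 : 0 ≤ 1 - 1 / (d : ℝ) := by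
    rw [sub_nonneg, div_le_one (by linarith)]; linarith
  have hp10 : 0 ≤ 1 - p := by linarith
  have ifW : ∏ y ∈ W, ∫⁻ z, (if y = v then g else f) z =
      ENNReal.ofReal ((1 - 1 / (d : ℝ)) ^ #W) := by
    rw [ENNReal.ofReal_pow hd0, ← prod_const]
    refine Finset.prod_congr rfl fun y hy => ?_
    rw [if_neg (by rintro rfl; exact hvW hy), if']
  rw [i0 hg', i0 hg, ig', ig, ifW, if_pos rfl, ig, hval, pathWeight, hdist, ← hc,
    ← ENNReal.ofReal_mul (by positivity), ← ENNReal.ofReal_mul hb0, ← ENNReal.ofReal_mul hp10,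
    ← ENNReal.ofReal_mul hb0, ← ENNReal.ofReal_mul (by norm_num),
    ← ENNReal.ofReal_add (by positivity) (by positivity),
    ← ENNReal.ofReal_add (by positivity) (by positivity)]
  refine ENNReal.ofReal_le_ofReal ?_
  have key := contraction_bound hd hc1 hcard
  rw [← hp'] at key
  calc _ = b * (p * p + (1 - p) + (1 - p) * (1 - 1 / (d : ℝ)) ^ #W) := by ring
    _ ≤ b * (3 / 2) := by gcongr
    _ = _ := by rw [hb]; ring

end Potential

/-! ### Union bound, diameter bound, and the upper bounds for regular graphs -/

section UpperBound

variable {V : Type*} [Fintype V] [DecidableEq V] (G : SimpleGraph V) [DecidableRel G.Adj]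

theorem sampleMeasure_white_le (hG : G.Connected) {d : ℕ} (hd : 2 ≤ d)
    (hreg : G.IsRegularOfDegree d) (s w : V) (t : ℕ) :
    sampleMeasure V {ω | w ∉ blue G {s} ω t} ≤
      ENNReal.ofReal (3 / 4) ^ t * ENNReal.ofReal (2 * (d : ℝ) ^ G.dist s w) := by
  have hm : MeasurableSet {ω : Sample V | w ∉ blue G {s} ω t} := by
    have := measurable_comp_blue G {s} t (fun B => w ∉ B)
    exact measurableSet_setOfPred.2 this
  have h1 : sampleMeasure V {ω | w ∉ blue G {s} ω t} ≤
      ∫⁻ ω, pathPotential G d w (blue G {s} ω t) ∂(sampleMeasure V) := by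
    rw [← lintegral_indicator_one hm]
    refine lintegral_mono fun ω => ?_
    by_cases h : w ∈ blue G {s} ω t
    · simp [h]
    · simpa [h] using one_le_pathPotential G hG hd hreg h
  refine h1.trans ((lintegral_blue_le_pow G {s} (fun B hB =>
    stepMean_pathPotential_le G hG hd hreg w ⟨s, hB (mem_singleton_self s)⟩) t).trans ?_)
  gcongr
  refine (pathPotential_le G (mem_singleton_self s)).trans (ENNReal.ofReal_le_ofReal ?_)
  have : closedBlueCount G {s} s = 1 := by
    rw [closedBlueCount_of_mem G (mem_singleton_self s)]
    simp
  simp [pathWeight, this]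

theorem sampleMeasure_ne_univ_le (hG : G.Connected) {d : ℕ} (hd : 2 ≤ d)
    (hreg : G.IsRegularOfDegree d) (s : V) {L : ℕ} (hL : ∀ w, G.dist s w ≤ L) (t : ℕ) :
    sampleMeasure V {ω | blue G {s} ω t ≠ univ} ≤
      ENNReal.ofReal ((3 / 4) ^ t * (Fintype.card V * (2 * (d : ℝ) ^ L))) := by
  have hsub : {ω : Sample V | blue G {s} ω t ≠ univ} ⊆
      ⋃ w ∈ (univ : Finset V), {ω | w ∉ blue G {s} ω t} := by
    intro ω h
    simpa [eq_univ_iff_forall] using h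
  refine (measure_mono hsub).trans ((measure_biUnion_finset_le _ _).trans ?_)
  refine (sum_le_sum fun w _ => sampleMeasure_white_le G hG hd hreg s w t).trans ?_
  have h1 : ∀ w ∈ (univ : Finset V), ENNReal.ofReal (3 / 4) ^ t *
      ENNReal.ofReal (2 * (d : ℝ) ^ G.dist s w) ≤
      ENNReal.ofReal ((3 / 4) ^ t * (2 * (d : ℝ) ^ L)) := by
    intro w _
    rw [← ENNReal.ofReal_pow (by norm_num), ← ENNReal.ofReal_mul (by positivity)]
    have : (1 : ℝ) ≤ d := by exact_mod_cast (by omega : 1 ≤ d)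
    gcongr
    exact hL w
  refine (sum_le_sum h1).trans ?_
  rw [sum_const, card_univ, nsmul_eq_mul, ← ENNReal.ofReal_natCast,
    ← ENNReal.ofReal_mul (by positivity)]
  exact ENNReal.ofReal_le_ofReal (le_of_eq (by ring))

/-- A sequence of probabilities with a geometric tail bound has a logarithmic sum. -/
theorem tsum_le_of_geometric_tail {a : ℕ → ℝ≥0∞} {M : ℝ} (hM : 1 ≤ M) (h1 : ∀ t, a t ≤ 1)
    (h2 : ∀ t, a t ≤ ENNReal.ofReal ((3 / 4) ^ t * M)) :
    ∑' t, a t ≤ ENNReal.ofReal (4 * Real.log M + 5) := by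
  -- Since log(3/4) ≤ -1/4, the tail bound is at most 1 from time `T` on. Earlier terms contribute
  -- at most T < 4 log M + 1, later ones at most the geometric sum 4.
  set T := ⌈4 * Real.log M⌉₊ with hT
  have hlog : 0 ≤ 4 * Real.log M := mul_nonneg (by norm_num) (Real.log_nonneg hM)
  have hT1 : 4 * Real.log M ≤ T := Nat.le_ceil _
  have hT2 : (T : ℝ) < 4 * Real.log M + 1 := Nat.ceil_lt_add_one hlog
  have hsmall : (3 / 4 : ℝ) ^ T * M ≤ 1 := by
    have h34 : Real.log (3 / 4) ≤ -(1 / 4) := by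
      have := Real.log_le_sub_one_of_pos (show (0 : ℝ) < 3 / 4 by norm_num)
      linarith
    have hpos : 0 < (3 / 4 : ℝ) ^ T * M := by positivity
    rw [← Real.log_nonpos_iff hpos.le, Real.log_mul (by positivity) (by positivity), Real.log_pow]
    nlinarith [Nat.cast_nonneg (α := ℝ) T]
  rw [← Summable.sum_add_tsum_nat_add' (k := T) ENNReal.summable]
  have hA : ∑ t ∈ range T, a t ≤ ENNReal.ofReal T := by
    calc _ ≤ ∑ t ∈ range T, (1 : ℝ≥0∞) := sum_le_sum fun t _ => h1 t
      _ = _ := by simp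
  have hB : ∑' t, a (t + T) ≤ ENNReal.ofReal 4 := by
    calc _ ≤ ∑' t, ENNReal.ofReal ((3 / 4) ^ t) := by
          refine ENNReal.tsum_le_tsum fun t => (h2 _).trans (ENNReal.ofReal_le_ofReal ?_)
          rw [pow_add, mul_assoc]
          exact mul_le_of_le_one_right (by positivity) hsmall
      _ = ENNReal.ofReal (∑' t : ℕ, (3 / 4 : ℝ) ^ t) :=
          (ENNReal.ofReal_tsum_of_nonneg (fun t => by positivity)
            (summable_geometric_of_lt_one (by norm_num) (by norm_num))).symm
      _ = _ := by rw [tsum_geometric_of_lt_one (by norm_num) (by norm_num)]; norm_num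
  refine (add_le_add hA hB).trans ?_
  rw [← ENNReal.ofReal_add (by positivity) (by norm_num)]
  exact ENNReal.ofReal_le_ofReal (by linarith)

omit [Fintype V] [DecidableEq V] [DecidableRel G.Adj] in
theorem exists_dist_eq (hG : G.Connected) (s w : V) {k : ℕ} (hk : k ≤ G.dist s w) :
    ∃ y, G.dist s y = k := by
  induction hk using Nat.decreasingInduction with
  | self => exact ⟨w, rfl⟩
  | of_succ k hk ih =>
    obtain ⟨y, hy⟩ := ih
    have hne : y ≠ s := by rintro rfl; simp at hy
    obtain ⟨z, _, hz⟩ := exists_adj_dist G hG hne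
    refine ⟨z, ?_⟩
    rw [G.dist_comm] at hy ⊢
    omega

/-- Choose one vertex at each distance from `s` up to dist(s,w). Their closed neighbourhoods have d
+ 1 elements each, and a vertex lies in at most three of them, since distances from `s` of adjacent
vertices differ by at most 1. -/
theorem succ_dist_mul_le (hG : G.Connected) {d : ℕ} (hreg : G.IsRegularOfDegree d) (s w : V) :
    (G.dist s w + 1) * (d + 1) ≤ 3 * Fintype.card V := by
  have h : ∀ k, ∃ y, k ≤ G.dist s w → G.dist s y = k := fun k => by
    by_cases hk : k ≤ G.dist s w
    · obtain ⟨y, hy⟩ := exists_dist_eq G hG s w hk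
      exact ⟨y, fun _ => hy⟩
    · exact ⟨s, fun h => absurd h hk⟩
  choose y hy using h
  have hN : ∀ k, #(insert (y k) (G.neighborFinset (y k))) = d + 1 := fun k => by
    rw [card_insert_of_notMem (by simp), G.card_neighborFinset_eq_degree, hreg.degree_eq]
  have hcount : ∑ k ∈ range (G.dist s w + 1), #(insert (y k) (G.neighborFinset (y k))) =
      ∑ v : V, #{k ∈ range (G.dist s w + 1) | v ∈ insert (y k) (G.neighborFinset (y k))} := by
    have := sum_card_bipartiteAbove_eq_sum_card_bipartiteBelow
      (fun k v => v ∈ insert (y k) (G.neighborFinset (y k))) (s := range (G.dist s w + 1))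
      (t := (univ : Finset V))
    simp only [bipartiteAbove, bipartiteBelow, filter_univ_mem] at this
    exact this
  have hthree : ∀ v : V,
      #{k ∈ range (G.dist s w + 1) | v ∈ insert (y k) (G.neighborFinset (y k))} ≤ 3 := by
    intro v
    refine (card_le_card (t := Icc (G.dist s v - 1) (G.dist s v + 1)) ?_).trans
      (by rw [Nat.card_Icc]; omega)
    intro k hk
    simp only [mem_filter, mem_range, mem_insert, SimpleGraph.mem_neighborFinset] at hk
    have h1 := hy k (by omega)
    rw [mem_Icc]
    rcases hk.2 with rfl | hadj
    · omega
    · have h2 := SimpleGraph.dist_eq_one_iff_adj.2 hadj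
      have h3 := hG.dist_triangle (u := s) (v := y k) (w := v)
      have h4 := hG.dist_triangle (u := s) (v := v) (w := y k)
      rw [G.dist_comm (u := v)] at h4
      omega
  calc (G.dist s w + 1) * (d + 1)
      = ∑ k ∈ range (G.dist s w + 1), #(insert (y k) (G.neighborFinset (y k))) := by simp [hN]
    _ ≤ ∑ _v : V, 3 := hcount ▸ sum_le_sum fun v _ => hthree v
    _ = _ := by simp [mul_comm]

/-- The bound from which both forms of the upper bound follow. -/
theorem ept_le (hG : G.Connected) {d : ℕ} (hd : 2 ≤ d) (hreg : G.IsRegularOfDegree d) :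
    ept G ≤ ENNReal.ofReal (12 * (Real.log d / (d + 1)) * Fintype.card V +
      (4 * Real.log (Fintype.card V) + 9)) := by
  obtain ⟨s⟩ := hG.nonempty
  obtain ⟨w, -, hw⟩ := exists_max_image univ (fun w => G.dist s w) ⟨s, mem_univ s⟩
  set L := G.dist s w
  have hcard := succ_dist_mul_le G hG hreg s w
  have hn : (1 : ℝ) ≤ Fintype.card V := by
    exact_mod_cast Fintype.card_pos_iff.2 ⟨s⟩
  have hd' : (2 : ℝ) ≤ d := by exact_mod_cast hd
  have hdL : (1 : ℝ) ≤ (d : ℝ) ^ L := one_le_pow₀ (by linarith)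
  refine (iInf_le _ s).trans ?_
  rw [eptFrom_eq_tsum]
  refine (tsum_le_of_geometric_tail (M := Fintype.card V * (2 * (d : ℝ) ^ L)) (by nlinarith)
    (fun t => prob_le_one)
    (fun t => sampleMeasure_ne_univ_le G hG hd hreg s (fun w => hw w (mem_univ w)) t)).trans ?_
  refine ENNReal.ofReal_le_ofReal ?_
  rw [Real.log_mul (by positivity) (by positivity), Real.log_mul (by norm_num) (by positivity),
    Real.log_pow]
  have hlog2 : Real.log 2 ≤ 1 := by linarith [Real.log_two_lt_d9]
  have hL : (L : ℝ) ≤ 3 * Fintype.card V / (d + 1) := by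
    rw [le_div_iff₀ (by positivity)]
    have h1 : L * (d + 1) ≤ 3 * Fintype.card V := by
      refine le_trans ?_ hcard
      gcongr; omega
    exact_mod_cast h1
  have hlogd : 0 ≤ Real.log d := Real.log_nonneg (by linarith)
  have : (L : ℝ) * Real.log d ≤ 3 * Fintype.card V / (d + 1) * Real.log d := by gcongr
  have e : 12 * (Real.log d / (d + 1)) * (Fintype.card V : ℝ) =
    4 * (3 * Fintype.card V / (d + 1) * Real.log d) := by ring
  rw [e]
  linarith

omit [DecidableEq V] in
theorem lt_card_of_regular (hG : G.Connected) {d : ℕ} (hreg : G.IsRegularOfDegree d) :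
    d < Fintype.card V := by
  obtain ⟨s⟩ := hG.nonempty
  rw [← hreg.degree_eq s]
  exact G.degree_lt_card_verts s

/-- With s = (d+1)/3 ≥ 4/3 one has s⁴ ≥ (4/3)⁴ > 3, hence s⁵ ≥ 3s > d. This turns the constant 12
into 60. -/
theorem log_le_five_mul_log {d : ℝ} (hd : 3 ≤ d) : Real.log d ≤ 5 * Real.log ((d + 1) / 3) := by
  have h : Real.log (((d + 1) / 3) ^ 5) = 5 * Real.log ((d + 1) / 3) := by
    rw [Real.log_pow]; norm_num
  rw [← h]
  apply Real.log_le_log (by linarith)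
  set s := (d + 1) / 3 with hs
  have hs1 : 4 / 3 ≤ s := by rw [hs]; linarith
  have hd1 : d = 3 * s - 1 := by rw [hs]; ring
  have h4 : (4 / 3 : ℝ) ^ 4 ≤ s ^ 4 := by gcongr
  rw [hd1, pow_succ]
  nlinarith

theorem ept_le_explicit (hG : G.Connected) {d : ℕ} (hd : 3 ≤ d) (hreg : G.IsRegularOfDegree d) :
    ept G ≤ ENNReal.ofReal (60 * (Real.log (((d : ℝ) + 1) / 3) / ((d : ℝ) + 1)) *
      (Fintype.card V : ℝ) + 13 * Real.log (Fintype.card V : ℝ)) := by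
  refine (ept_le G hG (by omega) hreg).trans (ENNReal.ofReal_le_ofReal ?_)
  have hd' : (3 : ℝ) ≤ d := by exact_mod_cast hd
  have hn : (3 : ℝ) ≤ Fintype.card V := by
    exact_mod_cast hd.trans (lt_card_of_regular G hG hreg).le
  have hlogn : 1 ≤ Real.log (Fintype.card V : ℝ) := by
    rw [Real.le_log_iff_exp_le (by linarith)]
    linarith [Real.exp_one_lt_d9]
  have h1 := log_le_five_mul_log hd'
  have h2 : 12 * (Real.log d / (d + 1)) * (Fintype.card V : ℝ) ≤
      60 * (Real.log (((d : ℝ) + 1) / 3) / ((d : ℝ) + 1)) * (Fintype.card V : ℝ) := by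
    have : Real.log d / (d + 1) ≤ 5 * Real.log (((d : ℝ) + 1) / 3) / ((d : ℝ) + 1) := by
      gcongr
    have h3 : 12 * (Real.log d / (d + 1)) ≤
        60 * (Real.log (((d : ℝ) + 1) / 3) / ((d : ℝ) + 1)) := by
      calc _ ≤ 12 * (5 * Real.log (((d : ℝ) + 1) / 3) / ((d : ℝ) + 1)) := by gcongr
        _ = _ := by ring
    gcongr
  linarith

theorem ept_le_const_mul (hG : G.Connected) {d : ℕ} (hd : 2 ≤ d) (hreg : G.IsRegularOfDegree d) :
    ept G ≤ ENNReal.ofReal (70 * ((Fintype.card V : ℝ) * (Real.log d / d))) := by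
  refine (ept_le G hG hd hreg).trans (ENNReal.ofReal_le_ofReal ?_)
  have hd' : (2 : ℝ) ≤ d := by exact_mod_cast hd
  have hdn := lt_card_of_regular G hG hreg
  set n : ℝ := ((Fintype.card V : ℕ) : ℝ) with hn
  have hdn' : (d : ℝ) + 1 ≤ n := by rw [hn]; exact_mod_cast hdn
  have hlogd : 0 < Real.log d := Real.log_pos (by linarith)
  have hlogn : 1 ≤ Real.log n := by
    rw [Real.le_log_iff_exp_le (by linarith)]
    linarith [Real.exp_one_lt_d9]
  have h1 : 12 * (Real.log d / (d + 1)) * n ≤ 12 * (n * (Real.log d / d)) := by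
    have : Real.log d / (d + 1) ≤ Real.log d / d := by gcongr; linarith
    nlinarith
  -- For d ≥ 3 this is monotonicity of log x / x, which decreases only from e on; d = 2 is therefore
  -- separate.
  have h2 : Real.log n ≤ 4 * (n * (Real.log d / d)) := by
    rcases eq_or_lt_of_le hd with h | h
    · have hl := Real.log_two_gt_d9
      have : Real.log n ≤ n - 1 := Real.log_le_sub_one_of_pos (by linarith)
      rw [← h]; push_cast
      nlinarith
    · have hd3 : (3 : ℝ) ≤ d := by exact_mod_cast h
      have he : Real.exp 1 ≤ d := by linarith [Real.exp_one_lt_d9]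
      have := Real.log_div_self_antitoneOn (show Real.exp 1 ≤ (d : ℝ) from he)
        (show Real.exp 1 ≤ n by linarith) (by linarith : (d : ℝ) ≤ n)
      simp only at this
      rw [div_le_iff₀ (by linarith)] at this
      have h0 : 0 ≤ Real.log d / d := by positivity
      nlinarith
  linarith

end UpperBound

/-! ### The doubly logarithmic scale -/

section DoubleLog

/-- The doubly logarithmic growth scale: it increases by a constant when `b` is replaced by a
multiple of `b ^ 2`. -/
noncomputable def growthScale (b : ℝ) : ℝ := Real.log (Real.log (7 * b) / Real.log 7)

theorem one_le_log_seven : 1 ≤ Real.log 7 := by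
  rw [Real.le_log_iff_exp_le (by norm_num)]
  linarith [Real.exp_one_lt_d9]

theorem log_seven_le_two : Real.log 7 ≤ 2 := by
  rw [Real.log_le_iff_le_exp (by norm_num)]
  have h1 := Real.exp_one_gt_d9
  have h2 : Real.exp 2 = Real.exp 1 * Real.exp 1 := by rw [← Real.exp_add]; norm_num
  rw [h2]
  nlinarith

theorem one_le_log_div {b : ℝ} (hb : 1 ≤ b) : 1 ≤ Real.log (7 * b) / Real.log 7 := by
  rw [one_le_div (by linarith [one_le_log_seven])]
  exact Real.log_le_log (by norm_num) (by linarith)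

theorem growthScale_one : growthScale 1 = 0 := by
  have : Real.log 7 ≠ 0 := by linarith [one_le_log_seven]
  simp [growthScale, this]

theorem growthScale_mono {b b' : ℝ} (hb : 1 ≤ b) (h : b ≤ b') :
    growthScale b ≤ growthScale b' := by
  have h7 := one_le_log_seven
  refine Real.log_le_log (by linarith [one_le_log_div hb]) ?_
  gcongr

theorem growthScale_nonneg {b : ℝ} (hb : 1 ≤ b) : 0 ≤ growthScale b :=
  Real.log_nonneg (one_le_log_div hb)

theorem growthScale_four_le : growthScale 4 ≤ 1 := by
  have h7 := one_le_log_seven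
  have h1 : Real.log (7 * 4) / Real.log 7 ≤ 2 := by
    rw [div_le_iff₀ (by linarith)]
    have : (2 : ℝ) * Real.log 7 = Real.log (7 ^ 2) := by rw [Real.log_pow]; norm_num
    rw [this]
    exact Real.log_le_log (by norm_num) (by norm_num)
  have h2 := one_le_log_div (b := 4) (by norm_num)
  have := Real.log_le_sub_one_of_pos (show 0 < Real.log (7 * 4) / Real.log 7 by linarith)
  unfold growthScale
  linarith

/-- Squaring 7b doubles its logarithm, which costs only log 2 on this scale. Any overshoot of b'
beyond 7b² is charged linearly through log x ≤ x - 1, so only the mean of b' will matter. -/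
theorem growthScale_le {b b' : ℝ} (hb : 1 ≤ b) (hb' : 1 ≤ b') :
    growthScale b' ≤ growthScale b + 1 + b' / (7 * b ^ 2) := by
  have h7 := one_le_log_seven
  set z := Real.log (7 * b) / Real.log 7 with hz
  set z' := Real.log (7 * b') / Real.log 7 with hz'
  have hz1 : 1 ≤ z := one_le_log_div hb
  have hz1' : 1 ≤ z' := one_le_log_div hb'
  have hx : 0 < b' / (7 * b ^ 2) := by positivity
  have hlog : Real.log (7 * b') ≤ 2 * Real.log (7 * b) + b' / (7 * b ^ 2) := by
    have h1 : 7 * b' = (7 * b) ^ 2 * (b' / (7 * b ^ 2)) := by field_simp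
    have h2 := Real.log_le_sub_one_of_pos hx
    rw [h1, Real.log_mul (by positivity) (by positivity), Real.log_pow]
    push_cast
    linarith
  have hzz : z' ≤ 2 * z + b' / (7 * b ^ 2) := by
    rw [hz', div_le_iff₀ (by linarith)]
    have : z * Real.log 7 = Real.log (7 * b) := by rw [hz]; field_simp
    nlinarith
  have h3 : Real.log z' ≤ Real.log (2 * z) + (z' / (2 * z) - 1) := by
    have h4 := Real.log_le_sub_one_of_pos (show 0 < z' / (2 * z) by positivity)
    rw [Real.log_div (by positivity) (by positivity)] at h4
    linarith
  have h5 : z' / (2 * z) - 1 ≤ b' / (7 * b ^ 2) := by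
    rw [sub_le_iff_le_add, div_le_iff₀ (by positivity)]
    nlinarith
  rw [Real.log_mul (by norm_num) (by positivity)] at h3
  unfold growthScale
  have := Real.log_two_lt_d9
  linarith

/-- The height of a layer in the potential for the lower bound. -/
noncomputable def layerHeight (d : ℕ) : ℝ := growthScale (d + 1) / 2

theorem layerHeight_nonneg (d : ℕ) : 0 ≤ layerHeight d := by
  have : 0 ≤ growthScale ((d : ℝ) + 1) := growthScale_nonneg (by simp)
  unfold layerHeight
  linarith

theorem layerHeight_le_sqrt (d : ℕ) : layerHeight d ≤ √((d : ℝ) + 1) := by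
  have h7 := one_le_log_seven
  have hd : (0 : ℝ) < (d : ℝ) + 1 := by positivity
  have h1 := one_le_log_div (b := (d : ℝ) + 1) (by simp)
  have h2 := Real.log_le_sub_one_of_pos
    (show 0 < Real.log (7 * ((d : ℝ) + 1)) / Real.log 7 by linarith)
  have h3 : Real.log (7 * ((d : ℝ) + 1)) / Real.log 7 - 1 ≤ Real.log ((d : ℝ) + 1) := by
    rw [sub_le_iff_le_add, div_le_iff₀ (by linarith),
      Real.log_mul (by norm_num) (by positivity)]
    nlinarith [Real.log_nonneg (show 1 ≤ (d : ℝ) + 1 by simp)]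
  have h4 : Real.log ((d : ℝ) + 1) ≤ 2 * √((d : ℝ) + 1) := by
    have h5 := Real.log_le_sub_one_of_pos (Real.sqrt_pos.2 hd)
    rw [Real.log_sqrt hd.le] at h5
    linarith
  unfold layerHeight growthScale
  linarith

/-- Because the height is half the full scale, the hypothesis says y² < z for the normalized
logarithms. Then 2y ≤ y² + 1 < z + 1, and removing logarithms gives 49b² < 49(d+1). -/
theorem sq_lt_of_growthScale_lt {b : ℝ} {d : ℕ} (hb : 1 ≤ b)
    (h : growthScale b < layerHeight d) : b ^ 2 < d + 1 := by
  have h7 := one_le_log_seven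
  have hd : (0 : ℝ) < (d : ℝ) + 1 := by positivity
  have h1 := one_le_log_div (b := (d : ℝ) + 1) (by simp)
  have h2 := one_le_log_div hb
  unfold layerHeight growthScale at h
  set z := Real.log (7 * ((d : ℝ) + 1)) / Real.log 7 with hz
  set y := Real.log (7 * b) / Real.log 7 with hy
  have h3 : y ^ 2 < z := by
    rw [← Real.log_lt_log_iff (by positivity) (by linarith), Real.log_pow]
    push_cast; linarith
  have h4 : 2 * y < z + 1 := by nlinarith [sq_nonneg (y - 1)]
  have e1 : y * Real.log 7 = Real.log (7 * b) := by rw [hy]; field_simp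
  have e2 : z * Real.log 7 = Real.log (7 * ((d : ℝ) + 1)) := by rw [hz]; field_simp
  have h5 : 2 * Real.log (7 * b) < Real.log (7 * ((d : ℝ) + 1)) + Real.log 7 := by
    rw [← e1, ← e2]; nlinarith
  rw [Real.log_mul (by norm_num) (by positivity), Real.log_mul (by norm_num) (by positivity)] at h5
  rw [← Real.log_lt_log_iff (by positivity) hd, Real.log_pow]
  push_cast
  linarith

theorem log_log_le_layerHeight {d : ℕ} (hd : 3 ≤ d) :
    Real.log (Real.log d) ≤ 4 * layerHeight d := by
  have h7 := one_le_log_seven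
  have h72 := log_seven_le_two
  have hd' : (3 : ℝ) ≤ d := by exact_mod_cast hd
  have hx : 0 < Real.log d := Real.log_pos (by linarith)
  have h1 : 1 + Real.log d / 2 ≤ Real.log (7 * ((d : ℝ) + 1)) / Real.log 7 := by
    rw [le_div_iff₀ (by linarith), Real.log_mul (by norm_num) (by positivity)]
    have : Real.log d ≤ Real.log ((d : ℝ) + 1) := Real.log_le_log (by linarith) (by linarith)
    nlinarith
  have h2 : Real.log (Real.log d) ≤ 2 * Real.log (1 + Real.log d / 2) := by
    have : 2 * Real.log (1 + Real.log d / 2) = Real.log ((1 + Real.log d / 2) ^ 2) := by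
      rw [Real.log_pow]; norm_num
    rw [this]
    exact Real.log_le_log hx (by nlinarith)
  have h3 := Real.log_le_log (by positivity) h1
  unfold layerHeight growthScale
  linarith

end DoubleLog

/-! ### Drift of the layer potential -/

section Layers

variable {V : Type*} [Fintype V] [DecidableEq V] (G : SimpleGraph V) [DecidableRel G.Adj]

/-- A partition of the vertices into layers with few edges between them. -/
structure IsLayering (l : V → ℕ) : Prop where
  le_succ : ∀ {u v}, G.Adj u v → l v ≤ l u + 1
  card_outside_le : ∀ u, #{v | G.Adj u v ∧ l v ≠ l u} ≤ 1
  card_cut_le : ∀ k, #{e : V × V | G.Adj e.1 e.2 ∧ l e.1 = k ∧ l e.2 = k + 1} ≤ 4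

/-- The number of blue vertices in the layer `k`. -/
def layerCount (l : V → ℕ) (B : Finset V) (k : ℕ) : ℕ := #{v ∈ B | l v = k}

/-- A potential that measures how far the blue set has advanced, by the index of the last layer
that it meets and the number of its vertices there. -/
noncomputable def layerPotential (l : V → ℕ) (K : ℝ) (B : Finset V) : ℝ :=
  K * (B.sup l : ℕ) + min K (growthScale (layerCount l B (B.sup l)))

variable {G} {l : V → ℕ}

omit [Fintype V] [DecidableEq V] in
theorem one_le_layerCount_sup {B : Finset V} (hB : B.Nonempty) :
    1 ≤ layerCount l B (B.sup l) := by
  obtain ⟨v, hv, h⟩ := exists_mem_eq_sup B hB l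
  exact card_pos.2 ⟨v, by simp [hv, h]⟩

/-- All of C[u] lies in the layer of `u`, except for at most one neighbour outside it. -/
theorem IsLayering.closedBlueCount_le (hl : IsLayering G l) {B : Finset V} {u : V} (hu : u ∈ B) :
    closedBlueCount G B u ≤ layerCount l B (l u) + 1 := by
  rw [closedBlueCount_of_mem G hu]
  have h1 : B ∩ G.neighborFinset u ⊆
      ({v ∈ B | l v = l u} : Finset V).erase u ∪ ({v | G.Adj u v ∧ l v ≠ l u} : Finset V) := by
    intro v hv
    simp only [mem_inter, SimpleGraph.mem_neighborFinset] at hv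
    by_cases h : l v = l u
    · simp [hv.1, h, hv.2.ne']
    · simp [hv.2, h]
  have h2 := (card_le_card h1).trans (card_union_le _ _)
  rw [card_erase_of_mem (by simp [hu])] at h2
  have h3 := hl.card_outside_le u
  have h4 : 1 ≤ #({v ∈ B | l v = l u} : Finset V) := card_pos.2 ⟨u, by simp [hu]⟩
  unfold layerCount
  omega

theorem IsLayering.forceProb_le (hl : IsLayering G l) {d : ℕ} (hreg : G.IsRegularOfDegree d)
    {B : Finset V} {u : V} (hu : u ∈ B) :
    forceProb G B u ≤ ((layerCount l B (l u) : ℝ) + 1) / d := by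
  rw [forceProb, hreg.degree_eq]
  gcongr
  exact_mod_cast hl.closedBlueCount_le hu

/-- The pairs `(u, v)` from a finite set along which `u` forces `v` in one step from `B`. -/
noncomputable def forcedPairs (G : SimpleGraph V) [DecidableRel G.Adj] (E : Finset (V × V))
    (x : V × V → I) (B : Finset V) : Finset (V × V) :=
  {e ∈ E | (x e : ℝ) ≤ forceProb G B e.1}

theorem measurable_card_forcedPairs (E : Finset (V × V)) (B : Finset V) :
    Measurable fun x : V × V → I => (#(forcedPairs G E x B) : ℝ≥0∞) := by
  simp only [forcedPairs, card_filter, Nat.cast_sum, Nat.cast_ite, Nat.cast_one, Nat.cast_zero]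
  exact Finset.measurable_fun_sum _ fun e _ =>
    Measurable.ite (measurableSet_forced G B e.1 e.2) measurable_const measurable_const

theorem lintegral_card_forcedPairs_le {E : Finset (V × V)} {B : Finset V} {q : ℝ}
    (hq : ∀ e ∈ E, forceProb G B e.1 ≤ q) :
    ∫⁻ x, (#(forcedPairs G E x B) : ℝ≥0∞) ∂(stepMeasure V) ≤ #E * ENNReal.ofReal q := by
  simp only [forcedPairs, card_filter, Nat.cast_sum, Nat.cast_ite, Nat.cast_one, Nat.cast_zero]
  rw [lintegral_finsetSum]
  · rw [← nsmul_eq_mul]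
    refine sum_le_card_nsmul _ _ _ fun e he => ?_
    calc _ = ∫⁻ x, {x : V × V → I | (x (e.1, e.2) : ℝ) ≤ forceProb G B e.1}.indicator 1 x
            ∂(stepMeasure V) := by
          refine lintegral_congr fun x => ?_
          simp [Set.indicator_apply]
      _ = stepMeasure V {x : V × V → I | (x (e.1, e.2) : ℝ) ≤ forceProb G B e.1} :=
          lintegral_indicator_one (measurableSet_forced G B e.1 e.2)
      _ ≤ _ := (stepMeasure_forced_le _ _).trans (ENNReal.ofReal_le_ofReal (hq e he))
  · exact fun e _ =>
      Measurable.ite (measurableSet_forced G B e.1 e.2) measurable_const measurable_const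

/-- New blue vertices in the last layer are forced from that layer, or from the preceding one
through a cut of at most 4 edges; no blue vertex lies further on. -/
theorem IsLayering.layerCount_step_le (hl : IsLayering G l) (x : V × V → I) (B : Finset V) :
    layerCount l (step G x B) (B.sup l) ≤ layerCount l B (B.sup l) + 4 +
      #(forcedPairs G {e | G.Adj e.1 e.2 ∧ e.1 ∈ B ∧ l e.1 = B.sup l} x B) := by
  set k := B.sup l with hk
  have hcut : #{e : V × V | G.Adj e.1 e.2 ∧ l e.1 + 1 = k ∧ l e.2 = k} ≤ 4 := by
    rcases Nat.eq_zero_or_pos k with h0 | h0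
    · simp [h0]
    · refine le_trans (card_le_card fun e he => ?_) (hl.card_cut_le (k - 1))
      simp only [mem_filter, mem_univ, true_and] at he ⊢
      exact ⟨he.1, by omega, by omega⟩
  have hsub : ({v ∈ step G x B | l v = k} : Finset V) ⊆ ({v ∈ B | l v = k} : Finset V) ∪
      ({e : V × V | G.Adj e.1 e.2 ∧ l e.1 + 1 = k ∧ l e.2 = k} : Finset (V × V)).image Prod.snd ∪
      (forcedPairs G {e | G.Adj e.1 e.2 ∧ e.1 ∈ B ∧ l e.1 = k} x B).image Prod.snd := by
    intro v hv
    simp only [mem_filter, mem_step] at hv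
    obtain ⟨hv | ⟨u, hu, huv, hx⟩, hvk⟩ := hv
    · simp [hv, hvk]
    · have h1 : l u ≤ k := hk ▸ le_sup (f := l) hu
      have h2 := hl.le_succ huv
      rcases eq_or_lt_of_le h1 with h | h
      · exact mem_union_right _ (mem_image.2 ⟨(u, v), by simp [forcedPairs, huv, hu, h, hx], rfl⟩)
      · refine mem_union_left _ (mem_union_right _ (mem_image.2 ⟨(u, v), ?_, rfl⟩))
        simp only [mem_filter, mem_univ, true_and]
        exact ⟨huv, by omega, hvk⟩
  have h1 := card_le_card hsub
  have h2 := (h1.trans (card_union_le _ _)).trans (Nat.add_le_add_right (card_union_le _ _) _)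
  refine h2.trans ?_
  unfold layerCount
  gcongr
  · exact card_image_le.trans hcut
  · exact card_image_le

theorem IsLayering.layerPotential_step_le (hl : IsLayering G l) (K : ℝ)
    (x : V × V → I) {B : Finset V} (hB : B.Nonempty) :
    layerPotential l K (step G x B) ≤ layerPotential l K B + 1 +
      layerCount l (step G x B) (B.sup l) / (7 * (layerCount l B (B.sup l) : ℝ) ^ 2) +
      (K - min K (growthScale (layerCount l B (B.sup l)))) *
        #(forcedPairs G {e | G.Adj e.1 e.2 ∧ e.1 ∈ B ∧ l e.1 = B.sup l ∧ l e.2 = B.sup l + 1}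
          x B) := by
  set k := B.sup l with hk
  set b := layerCount l B k with hb
  set E : Finset (V × V) := {e | G.Adj e.1 e.2 ∧ e.1 ∈ B ∧ l e.1 = k ∧ l e.2 = k + 1} with hE
  have hb1 : 1 ≤ b := one_le_layerCount_sup hB
  have hb1' : (1 : ℝ) ≤ b := by exact_mod_cast hb1
  have hR : 0 ≤ K - min K (growthScale b) := sub_nonneg.2 (min_le_left _ _)
  have hback : ∀ v ∈ step G x B, v ∈ B ∨ ∃ u, (u, v) ∈ forcedPairs G
      {e | G.Adj e.1 e.2 ∧ e.1 ∈ B} x B := by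
    intro v hv
    rcases (mem_step G).1 hv with h | ⟨u, hu, huv, hx⟩
    · exact Or.inl h
    · exact Or.inr ⟨u, by simp [forcedPairs, hu, huv, hx]⟩
  have hforced : ∀ v ∈ step G x B, k < l v → l v = k + 1 ∧ ∃ u, (u, v) ∈ forcedPairs G E x B := by
    intro v hv hlt
    rcases hback v hv with h | ⟨u, h⟩
    · have : l v ≤ k := le_sup (f := l) h
      omega
    · simp only [forcedPairs, mem_filter, mem_univ, true_and] at h
      have h1 : l u ≤ k := le_sup (f := l) h.1.2
      have h2 := hl.le_succ h.1.1
      refine ⟨by omega, u, ?_⟩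
      simp only [forcedPairs, hE, mem_filter, mem_univ, true_and]
      exact ⟨⟨h.1.1, h.1.2, by omega, by omega⟩, h.2⟩
  have hkle : k ≤ (step G x B).sup l := sup_mono (subset_step G x B)
  -- On entering layer k + 1, at most 4 of its vertices are blue, so the new growth term is at most
  -- 1; the remaining gain is `K - min K (growthScale b)`, paid by at least one forced cut edge.
  -- Otherwise only the growth term changes.
  by_cases hnew : ∃ v ∈ step G x B, k < l v
  · obtain ⟨v, hv, hvk⟩ := hnew
    have hsup : (step G x B).sup l = k + 1 := by
      apply le_antisymm
      · refine Finset.sup_le fun y hy => ?_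
        by_contra h
        have := (hforced y hy (by omega)).1
        omega
      · rw [← (hforced v hv hvk).1]
        exact le_sup (f := l) hv
    have hF : 1 ≤ #(forcedPairs G E x B) := by
      obtain ⟨-, u, hu⟩ := hforced v hv hvk
      exact card_pos.2 ⟨_, hu⟩
    have hF' : (1 : ℝ) ≤ #(forcedPairs G E x B) := by exact_mod_cast hF
    have hcount : layerCount l (step G x B) (k + 1) ≤ 4 := by
      refine le_trans ?_ (hl.card_cut_le k)
      refine le_trans (card_le_card ?_) (card_image_le (f := Prod.snd))
      intro y hy
      simp only [mem_filter] at hy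
      obtain ⟨-, u, hu⟩ := hforced y hy.1 (by omega)
      simp only [forcedPairs, hE, mem_filter, mem_univ, true_and] at hu
      refine mem_image.2 ⟨(u, y), ?_, rfl⟩
      simp only [mem_filter, mem_univ, true_and]
      exact ⟨hu.1.1, hu.1.2.2⟩
    have hc1 : (1 : ℝ) ≤ layerCount l (step G x B) (k + 1) := by
      have := one_le_layerCount_sup (l := l) (hB.mono (subset_step G x B))
      rw [hsup] at this
      exact_mod_cast this
    have h1 : growthScale (layerCount l (step G x B) (k + 1)) ≤ 1 :=
      (growthScale_mono hc1 (by exact_mod_cast hcount)).trans growthScale_four_le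
    have h2 : (0 : ℝ) ≤ layerCount l (step G x B) k / (7 * (b : ℝ) ^ 2) := by positivity
    have h3 := min_le_right K (growthScale (layerCount l (step G x B) (k + 1)))
    unfold layerPotential
    rw [hsup, ← hk, ← hb]
    push_cast
    nlinarith
  · push Not at hnew
    have hsup : (step G x B).sup l = k := le_antisymm (Finset.sup_le hnew) hkle
    have hc : (b : ℝ) ≤ layerCount l (step G x B) k := by
      have : b ≤ layerCount l (step G x B) k :=
        card_le_card (filter_subset_filter _ (subset_step G x B))
      exact_mod_cast this
    have h1 := growthScale_le hb1' (hb1'.trans hc)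
    have h2 : min K (growthScale (layerCount l (step G x B) k)) ≤
        min K (growthScale b) + 1 + layerCount l (step G x B) k / (7 * (b : ℝ) ^ 2) := by
      have h4 : (0 : ℝ) ≤ layerCount l (step G x B) k / (7 * (b : ℝ) ^ 2) := by positivity
      rcases min_choice K (growthScale b) with h | h
      · rw [h]
        exact (min_le_left _ _).trans (by linarith)
      · rw [h]
        exact (min_le_right _ _).trans h1
    have h3 : 0 ≤ (K - min K (growthScale b)) * #(forcedPairs G E x B) := by positivity
    unfold layerPotential
    rw [hsup, ← hk, ← hb]
    linarith

theorem IsLayering.stepMean_layerPotential_le (hl : IsLayering G l) {d : ℕ} (hd : 1 ≤ d)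
    (hreg : G.IsRegularOfDegree d) {B : Finset V} (hB : B.Nonempty) :
    stepMean G (fun B => ENNReal.ofReal (layerPotential l (layerHeight d) B)) B ≤
      ENNReal.ofReal (layerPotential l (layerHeight d) B) + ENNReal.ofReal 18 := by
  set K := layerHeight d with hKdef
  have hK : 0 ≤ K := layerHeight_nonneg d
  set k := B.sup l with hk
  set b := layerCount l B k with hb
  have hb1 : 1 ≤ b := one_le_layerCount_sup hB
  have hb1' : (1 : ℝ) ≤ b := by exact_mod_cast hb1
  have hd' : (1 : ℝ) ≤ d := by exact_mod_cast hd
  set R := K - min K (growthScale b) with hRdef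
  have hR : 0 ≤ R := sub_nonneg.2 (min_le_left _ _)
  set E1 : Finset (V × V) := {e | G.Adj e.1 e.2 ∧ e.1 ∈ B ∧ l e.1 = k} with hE1
  set E2 : Finset (V × V) := {e | G.Adj e.1 e.2 ∧ e.1 ∈ B ∧ l e.1 = k ∧ l e.2 = k + 1} with hE2
  have hpot : 0 ≤ layerPotential l K B := by
    have := growthScale_nonneg hb1'
    unfold layerPotential
    rw [← hk, ← hb]
    positivity
  have hpt : ∀ x : V × V → I, ENNReal.ofReal (layerPotential l K (step G x B)) ≤
      ENNReal.ofReal (layerPotential l K B + 1) +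
        (ENNReal.ofReal (1 / (7 * (b : ℝ) ^ 2)) * ((b + 4 : ℕ) + #(forcedPairs G E1 x B)) +
        ENNReal.ofReal R * #(forcedPairs G E2 x B)) := by
    intro x
    have h1 := hl.layerPotential_step_le K x hB
    have h2 := hl.layerCount_step_le x B
    rw [← hk, ← hb, ← hE2, ← hRdef] at h1
    rw [← hk, ← hb, ← hE1] at h2
    rw [← Nat.cast_add, ← ENNReal.ofReal_natCast, ← ENNReal.ofReal_natCast,
      ← ENNReal.ofReal_mul (by positivity), ← ENNReal.ofReal_mul hR,
      ← ENNReal.ofReal_add (by positivity) (by positivity),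
      ← ENNReal.ofReal_add (by positivity) (by positivity)]
    refine ENNReal.ofReal_le_ofReal (h1.trans ?_)
    have h3 : (layerCount l (step G x B) k : ℝ) ≤ ((b + 4 + #(forcedPairs G E1 x B) : ℕ) : ℝ) := by
      exact_mod_cast h2
    have h4 : (layerCount l (step G x B) k : ℝ) / (7 * (b : ℝ) ^ 2) ≤
        1 / (7 * (b : ℝ) ^ 2) * ((b + 4 + #(forcedPairs G E1 x B) : ℕ) : ℝ) := by
      rw [one_div_mul_eq_div]
      gcongr
    linarith
  have hprob : ∀ u ∈ B, l u = k → forceProb G B u ≤ ((b : ℝ) + 1) / d := by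
    intro u hu huk
    have := hl.forceProb_le hreg hu
    rwa [huk, ← hb] at this
  have hcard1 : #E1 ≤ b * d := by
    have : E1 ⊆ ({v ∈ B | l v = k} : Finset V).biUnion fun u =>
        (G.neighborFinset u).image fun v => (u, v) := by
      rintro ⟨u, v⟩ he
      simp only [hE1, mem_filter, mem_univ, true_and] at he
      simp [he.2.1, he.2.2, he.1]
    refine (card_le_card this).trans ?_
    refine card_biUnion_le_card_mul _ _ _ fun u _ => card_image_le.trans ?_
    rw [G.card_neighborFinset_eq_degree, hreg.degree_eq]
  have hcard2 : #E2 ≤ 4 := by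
    refine le_trans (card_le_card fun e he => ?_) (hl.card_cut_le k)
    simp only [hE2, mem_filter, mem_univ, true_and] at he ⊢
    exact ⟨he.1, he.2.2⟩
  have hI1 : ∫⁻ x, (#(forcedPairs G E1 x B) : ℝ≥0∞) ∂(stepMeasure V) ≤
      ENNReal.ofReal (b * (b + 1)) := by
    refine (lintegral_card_forcedPairs_le (q := ((b : ℝ) + 1) / d) fun e he => ?_).trans ?_
    · simp only [hE1, mem_filter, mem_univ, true_and] at he
      exact hprob _ he.2.1 he.2.2
    · rw [← ENNReal.ofReal_natCast, ← ENNReal.ofReal_mul (by positivity)]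
      refine ENNReal.ofReal_le_ofReal ?_
      have : (#E1 : ℝ) ≤ b * d := by exact_mod_cast hcard1
      calc _ ≤ (b * d : ℝ) * (((b : ℝ) + 1) / d) := by gcongr
        _ = _ := by field_simp
  have hI2 : ∫⁻ x, (#(forcedPairs G E2 x B) : ℝ≥0∞) ∂(stepMeasure V) ≤
      ENNReal.ofReal (4 * ((b + 1) / d)) := by
    refine (lintegral_card_forcedPairs_le (q := ((b : ℝ) + 1) / d) fun e he => ?_).trans ?_
    · simp only [hE2, mem_filter, mem_univ, true_and] at he
      exact hprob _ he.2.1 he.2.2.1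
    · rw [← ENNReal.ofReal_natCast, ← ENNReal.ofReal_mul (by positivity)]
      refine ENNReal.ofReal_le_ofReal ?_
      have : (#E2 : ℝ) ≤ 4 := by exact_mod_cast hcard2
      gcongr
  -- Unless truncation makes `R` vanish, b and `R` are both at most √(d+1), so Rb ≤ d + 1. With b ≥
  -- 1 and d ≥ 1 this gives 4R(b+1) ≤ 8(d+1) ≤ 16d.
  have hRb : R * (4 * ((b + 1) / d)) ≤ 16 := by
    rcases le_or_gt K (growthScale b) with h | h
    · rw [hRdef, min_eq_left h]; simp
    · have h1 : R ≤ √((d : ℝ) + 1) := by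
        have := growthScale_nonneg hb1'
        rw [hRdef, min_eq_right h.le]
        linarith [layerHeight_le_sqrt d]
      have h2 : (b : ℝ) ≤ √((d : ℝ) + 1) :=
        Real.le_sqrt_of_sq_le (sq_lt_of_growthScale_lt hb1' h).le
      have h3 : R * b ≤ d + 1 := by
        calc R * b ≤ √((d : ℝ) + 1) * √((d : ℝ) + 1) := by gcongr
          _ = _ := Real.mul_self_sqrt (by positivity)
      have : R * (4 * ((b + 1) / d)) = R * (4 * (b + 1)) / d := by ring
      rw [this, div_le_iff₀ (by linarith)]
      nlinarith
  refine (lintegral_mono hpt).trans ?_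
  have m1 := measurable_card_forcedPairs (G := G) E1 B
  have m2 := measurable_card_forcedPairs (G := G) E2 B
  rw [lintegral_add_left measurable_const, lintegral_add_right _ (m2.const_mul _),
    lintegral_const_mul _ (m1.const_add _), lintegral_const_mul _ m2,
    lintegral_add_left measurable_const, lintegral_const, lintegral_const, measure_univ, mul_one,
    mul_one]
  calc _ ≤ ENNReal.ofReal (layerPotential l K B + 1) +
        (ENNReal.ofReal (1 / (7 * (b : ℝ) ^ 2)) *
          (((b + 4 : ℕ) : ℝ≥0∞) + ENNReal.ofReal (b * (b + 1))) +
        ENNReal.ofReal R * ENNReal.ofReal (4 * ((b + 1) / d))) := by gcongr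
    _ = ENNReal.ofReal (layerPotential l K B + 1 +
        (1 / (7 * (b : ℝ) ^ 2) * (((b + 4 : ℕ) : ℝ) + b * (b + 1)) +
          R * (4 * ((b + 1) / d)))) := by
      rw [← ENNReal.ofReal_natCast, ← ENNReal.ofReal_mul hR,
        ← ENNReal.ofReal_add (by positivity) (by positivity),
        ← ENNReal.ofReal_mul (by positivity),
        ← ENNReal.ofReal_add (by positivity) (by positivity),
        ← ENNReal.ofReal_add (by positivity) (by positivity)]
    _ ≤ ENNReal.ofReal (layerPotential l K B + 18) := by
      refine ENNReal.ofReal_le_ofReal ?_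
      -- The mean new count is at most b² + 2b + 4 ≤ 7b², which explains the 7 in the growth scale.
      -- The drift is then 1 + 1 + 16 = 18.
      have : 1 / (7 * (b : ℝ) ^ 2) * (((b + 4 : ℕ) : ℝ) + b * (b + 1)) ≤ 1 := by
        rw [one_div_mul_eq_div, div_le_one (by positivity)]
        push_cast
        nlinarith
      linarith
    _ = _ := ENNReal.ofReal_add hpot (by norm_num)

theorem IsLayering.le_eptFrom (hl : IsLayering G l) {d : ℕ} (hd : 1 ≤ d)
    (hreg : G.IsRegularOfDegree d) {s : V} (hs : l s = 0) {M : ℕ} (hM : ∀ v, l v ≤ M)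
    (hcount : d + 1 ≤ #{v | l v = M}) :
    ENNReal.ofReal (layerHeight d * (M + 1) / 18) ≤ eptFrom G {s} := by
  have hK := layerHeight_nonneg d
  have key := le_add_mul_eptFrom G {s} (D := ENNReal.ofReal 18) (by simp)
    (F := fun B => ENNReal.ofReal (layerPotential l (layerHeight d) B))
    (fun B hB _ => hl.stepMean_layerPotential_le hd hreg ⟨s, hB (mem_singleton_self s)⟩)
  have h0 : layerPotential l (layerHeight d) {s} = 0 := by
    have : layerCount l {s} (0 : ℕ) = 1 := by simp [layerCount, filter_singleton, hs]
    simp [layerPotential, hs, this, growthScale_one, hK]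
  have hsup : (univ : Finset V).sup l = M := by
    refine le_antisymm (Finset.sup_le fun v _ => hM v) ?_
    obtain ⟨v, hv⟩ := card_pos.1 (Nat.lt_of_lt_of_le (Nat.succ_pos d) hcount)
    rw [← (mem_filter.1 hv).2]
    exact le_sup (f := l) (mem_univ v)
  have h1 : layerHeight d * (M + 1) ≤ layerPotential l (layerHeight d) univ := by
    have hc : ((d : ℝ) + 1) ≤ layerCount l univ M := by exact_mod_cast hcount
    -- A full last layer saturates the truncated term, which contributes one extra height.
    have h2 : 2 * layerHeight d ≤ growthScale (layerCount l univ M) := by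
      have := growthScale_mono (by simp) hc
      unfold layerHeight
      linarith
    rw [layerPotential, hsup, min_eq_left (by linarith)]
    linarith
  simp only [h0, ENNReal.ofReal_zero, zero_add] at key
  rw [ENNReal.ofReal_div_of_pos (by norm_num)]
  exact ENNReal.div_le_of_le_mul' ((ENNReal.ofReal_le_ofReal h1).trans key)

end Layers

/-! ### The ring of cliques and its layering -/

section RingOfCliques

variable {m d : ℕ} [NeZero m]

/-- The change of the clique index along an edge of the ring of cliques, in terms of the positions
of its two ends in their cliques. -/
def ringShift (m d : ℕ) [NeZero m] (j j' : Fin (d + 1)) : Fin m :=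
  if j = 0 ∧ j' = Fin.last d then 1 else if j = Fin.last d ∧ j' = 0 then -1 else 0

/-- A neighbour is determined by its position, with one for each of the d other positions. This
stays valid for m ≤ 2, where some of the shifts 0, 1, -1 coincide. -/
theorem ringOfCliques_adj_iff (hd : 1 ≤ d) (x y : Fin m × Fin (d + 1)) :
    (ringOfCliques m d).Adj x y ↔ x.2 ≠ y.2 ∧ y.1 = x.1 + ringShift m d x.2 y.2 := by
  have h0 : (0 : Fin (d + 1)) ≠ Fin.last d := by
    intro h
    have := congrArg Fin.val h
    simp at this
    omega
  obtain ⟨i, j⟩ := x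
  obtain ⟨i', j'⟩ := y
  have hneg : i' = i + -1 ↔ i = i' + 1 := by
    constructor <;> rintro rfl <;> simp
  simp only [ringOfCliques, cliques, deletedEdges, insertedEdges, SimpleGraph.sup_adj,
    SimpleGraph.sdiff_adj, SimpleGraph.fromRel_adj, ringShift, ne_eq, Prod.mk.injEq]
  by_cases h1 : j = 0 ∧ j' = Fin.last d
  · obtain ⟨rfl, rfl⟩ := h1
    simp [h0, h0.symm]
    tauto
  · by_cases h2 : j = Fin.last d ∧ j' = 0
    · obtain ⟨rfl, rfl⟩ := h2
      rw [if_neg h1, if_pos ⟨rfl, rfl⟩, hneg]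
      simp [h0, h0.symm]
      tauto
    · rw [if_neg h1, if_neg h2, add_zero]
      have e1 : (¬(i = i' ∧ j = j') ∧ (i = i' ∨ i' = i)) ↔ (¬ j = j' ∧ i' = i) := by
        constructor
        · rintro ⟨h, rfl | rfl⟩ <;> simpa using h
        · rintro ⟨h, rfl⟩; simpa using h
      have a1 : ∀ P : Prop, ¬(P ∧ j = 0 ∧ j' = Fin.last d) := fun _ h => h1 h.2
      have a2 : ∀ P : Prop, ¬(P ∧ j' = 0 ∧ j = Fin.last d) := fun _ h => h2 ⟨h.2.2, h.2.1⟩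
      simp only [e1, a1, a2, or_self, and_false, not_false_eq_true, and_true, or_false]

theorem ringOfCliques_isRegularOfDegree (hd : 1 ≤ d) :
    (ringOfCliques m d).IsRegularOfDegree d := by
  intro x
  have : (ringOfCliques m d).neighborFinset x =
      (univ.erase x.2).image fun j => (x.1 + ringShift m d x.2 j, j) := by
    ext ⟨i, j⟩
    simp only [SimpleGraph.mem_neighborFinset, ringOfCliques_adj_iff hd, mem_image, mem_erase,
      mem_univ, and_true, Prod.mk.injEq]
    constructor
    · rintro ⟨h1, h2⟩
      exact ⟨j, Ne.symm h1, h2.symm, rfl⟩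
    · rintro ⟨j', h1, h2, rfl⟩
      exact ⟨Ne.symm h1, h2.symm⟩
  rw [← SimpleGraph.card_neighborFinset_eq_degree, this, card_image_of_injective]
  · simp
  · intro j j' h
    exact (Prod.mk.inj h).2

theorem ringOfCliques_connected (hd : 2 ≤ d) : (ringOfCliques m d).Connected := by
  -- Position 1 is not a designated one, as d ≥ 2, so this vertex remains adjacent to the rest of
  -- its clique.
  set c : Fin (d + 1) := ⟨1, by omega⟩ with hc
  have hc0 : c ≠ 0 := by
    intro h; have := congrArg Fin.val h; simp [hc] at this
  have hcl : c ≠ Fin.last d := by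
    intro h; have := congrArg Fin.val h; simp [hc] at this; omega
  have h0 : (0 : Fin (d + 1)) ≠ Fin.last d := by
    intro h; have := congrArg Fin.val h; simp at this; omega
  have hin : ∀ i j, (ringOfCliques m d).Reachable (i, c) (i, j) := by
    intro i j
    by_cases h : c = j
    · rw [h]
    · refine SimpleGraph.Adj.reachable ((ringOfCliques_adj_iff (by omega) _ _).2 ⟨h, ?_⟩)
      simp [ringShift, hc0, hcl]
  have hnext : ∀ i, (ringOfCliques m d).Reachable (i, c) (i + 1, c) := by
    intro i
    refine (hin i 0).trans (SimpleGraph.Reachable.trans (SimpleGraph.Adj.reachable ?_)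
      (hin (i + 1) (Fin.last d)).symm)
    refine (ringOfCliques_adj_iff (by omega) _ _).2 ⟨h0, ?_⟩
    simp [ringShift]
  have hall : ∀ n : ℕ, (ringOfCliques m d).Reachable (0, c) (Fin.ofNat m n, c) := by
    intro n
    induction n with
    | zero => exact SimpleGraph.Reachable.refl _
    | succ n ih =>
      have : Fin.ofNat m (n + 1) = Fin.ofNat m n + 1 := by
        ext; simp [Fin.val_add, Nat.add_mod]
      rw [this]
      exact ih.trans (hnext _)
  have hroot : ∀ x, (ringOfCliques m d).Reachable (0, c) x := by
    rintro ⟨i, j⟩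
    have := hall i.val
    rw [show Fin.ofNat m i.val = i by ext; simp] at this
    exact this.trans (hin i j)
  have : Nonempty (Fin m × Fin (d + 1)) := ⟨(0, c)⟩
  exact SimpleGraph.Connected.mk fun x y => (hroot x).symm.trans (hroot y)

/-- The distance from `0` in the cycle of length `m`. -/
def cycleDist (a : Fin m) : ℕ := min a.val (m - a.val)

omit [NeZero m] in
theorem cycleDist_le (a : Fin m) : cycleDist a ≤ m / 2 := by
  unfold cycleDist; omega

theorem cycleDist_add_one_le (a : Fin m) : cycleDist (a + 1) ≤ cycleDist a + 1 := by
  unfold cycleDist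
  have ha := a.2
  rcases Nat.lt_or_ge 1 m with h1 | h1
  · rcases Nat.lt_or_ge (a.val + 1) m with h | h
    · have : (a + 1).val = a.val + 1 := by
        rw [Fin.val_add, Fin.val_one', Nat.mod_eq_of_lt h1, Nat.mod_eq_of_lt h]
      omega
    · have : (a + 1).val = 0 := by
        rw [Fin.val_add, Fin.val_one', Nat.mod_eq_of_lt h1, show a.val + 1 = m by omega,
          Nat.mod_self]
      omega
  · have := (a + 1).2
    omega

omit [NeZero m] in
theorem cycleDist_neg (a : Fin m) : cycleDist (-a) = cycleDist a := by
  unfold cycleDist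
  have ha := a.2
  rw [Fin.val_neg']
  rcases Nat.eq_zero_or_pos a.val with h | h
  · simp [h]
  · rw [Nat.mod_eq_of_lt (by omega)]
    omega

theorem cycleDist_sub_one_le (a : Fin m) : cycleDist (a + -1) ≤ cycleDist a + 1 := by
  rw [← cycleDist_neg, ← cycleDist_neg a, neg_add, neg_neg]
  exact cycleDist_add_one_le _

theorem card_cycleDist_eq_le (i : Fin m) (k : ℕ) : #{a : Fin m | cycleDist (a - i) = k} ≤ 2 := by
  have : #{a : Fin m | cycleDist (a - i) = k} ≤ #({k, m - k} : Finset ℕ) := by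
    refine card_le_card_of_injOn (fun a => (a - i).val) ?_ ?_
    · intro a ha
      have ha' : cycleDist (a - i) = k := (mem_filter.1 (mem_coe.1 ha)).2
      have := (a - i).2
      unfold cycleDist at ha'
      simp only [coe_insert, coe_singleton, Set.mem_insert_iff, Set.mem_singleton_iff]
      omega
    · intro a _ b _ h
      exact sub_left_injective (Fin.ext h)
  exact this.trans card_le_two

theorem ringOfCliques_isLayering (hd : 1 ≤ d) (i : Fin m) :
    IsLayering (ringOfCliques m d) fun x => cycleDist (x.1 - i) := by
  have hshift : ∀ {u v : Fin m × Fin (d + 1)}, (ringOfCliques m d).Adj u v →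
      cycleDist (v.1 - i) ≠ cycleDist (u.1 - i) →
      (u.2 = 0 ∧ v.2 = Fin.last d) ∨ (u.2 = Fin.last d ∧ v.2 = 0) := by
    intro u v h hne
    by_contra hcon
    push Not at hcon
    rw [ringOfCliques_adj_iff hd] at h
    have hs : ringShift m d u.2 v.2 = 0 := by
      unfold ringShift
      rw [if_neg (fun h => hcon.1 h.1 h.2), if_neg (fun h => hcon.2 h.1 h.2)]
    rw [hs, add_zero] at h
    exact hne (by rw [h.2])
  have h0 : (0 : Fin (d + 1)) ≠ Fin.last d := by
    intro h; have := congrArg Fin.val h; simp at this; omega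
  -- An edge leaving a layer joins opposite designated positions, so its first end determines its
  -- second.
  have hdet : ∀ {u v v' : Fin m × Fin (d + 1)}, (ringOfCliques m d).Adj u v →
      (ringOfCliques m d).Adj u v' → cycleDist (v.1 - i) ≠ cycleDist (u.1 - i) →
      cycleDist (v'.1 - i) ≠ cycleDist (u.1 - i) → v = v' := by
    intro u v v' h h' hne hne'
    have h2 : v.2 = v'.2 := by
      rcases hshift h hne with h1 | h1 <;> rcases hshift h' hne' with h1' | h1'
      · rw [h1.2, h1'.2]
      · exact absurd (h1.1.symm.trans h1'.1) h0
      · exact absurd (h1'.1.symm.trans h1.1) h0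
      · rw [h1.2, h1'.2]
    rw [ringOfCliques_adj_iff hd] at h h'
    exact Prod.ext (by rw [h.2, h'.2, h2]) h2
  refine ⟨?_, ?_, ?_⟩
  · intro u v h
    rw [ringOfCliques_adj_iff hd] at h
    rw [h.2, add_sub_right_comm]
    unfold ringShift
    split_ifs
    · exact cycleDist_add_one_le _
    · exact cycleDist_sub_one_le _
    · simp
  · intro u
    refine card_le_one.2 fun v hv v' hv' => ?_
    simp only [mem_filter, mem_univ, true_and] at hv hv'
    exact hdet hv.1 hv'.1 hv.2 hv'.2
  · intro k
    -- At most two cliques lie at distance k, each with two designated vertices, and each of these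
    -- starts at most one cut edge.
    have : #{e : (Fin m × Fin (d + 1)) × (Fin m × Fin (d + 1)) |
        (ringOfCliques m d).Adj e.1 e.2 ∧ cycleDist (e.1.1 - i) = k ∧
          cycleDist (e.2.1 - i) = k + 1} ≤
        #(({a : Fin m | cycleDist (a - i) = k} : Finset (Fin m)) ×ˢ
          ({0, Fin.last d} : Finset (Fin (d + 1)))) := by
      refine card_le_card_of_injOn Prod.fst ?_ ?_
      · intro e he
        simp only [mem_coe, mem_filter, mem_univ, true_and] at he
        have := hshift he.1 (by omega)
        simp only [coe_product, Set.mem_prod, mem_coe, mem_filter, mem_univ, true_and, mem_insert,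
          mem_singleton]
        exact ⟨he.2.1, by tauto⟩
      · intro e he e' he' h
        simp only [mem_coe, mem_filter, mem_univ, true_and] at he he'
        refine Prod.ext h (hdet (u := e.1) he.1 (h ▸ he'.1) (by omega) ?_)
        rw [h]; omega
    refine this.trans ?_
    rw [card_product]
    exact Nat.mul_le_mul (card_cycleDist_eq_le i k) card_le_two

theorem le_ept_ringOfCliques (hd : 3 ≤ d) :
    ENNReal.ofReal (1 / 300 * (((m * (d + 1) : ℕ) : ℝ) * (Real.log (Real.log d) / d))) ≤
      ept (ringOfCliques m d) := by
  refine le_iInf fun s => ?_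
  have hmpos : 0 < m := Nat.pos_of_ne_zero (NeZero.ne m)
  have hlow := (ringOfCliques_isLayering (d := d) (by omega) s.1).le_eptFrom (d := d) (by omega)
    (ringOfCliques_isRegularOfDegree (by omega)) (s := s) (M := m / 2)
    (by simp [cycleDist]) (fun v => cycleDist_le _) (by
      -- The clique opposite the start fills the last layer with at least d + 1 vertices.
      have hsub : (univ : Finset (Fin (d + 1))).image
          (fun j => ((⟨m / 2, by omega⟩ : Fin m) + s.1, j)) ⊆
          ({v | cycleDist (v.1 - s.1) = m / 2} : Finset (Fin m × Fin (d + 1))) := by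
        intro v hv
        obtain ⟨j, -, rfl⟩ := mem_image.1 hv
        refine mem_filter.2 ⟨mem_univ _, ?_⟩
        rw [add_sub_cancel_right]
        unfold cycleDist
        simp only
        omega
      refine le_trans ?_ (card_le_card hsub)
      rw [card_image_of_injective _ fun j j' h => (Prod.mk.inj h).2]
      simp)
  refine le_trans (ENNReal.ofReal_le_ofReal ?_) hlow
  have hd' : (3 : ℝ) ≤ d := by exact_mod_cast hd
  have hK := layerHeight_nonneg d
  have h1 := log_log_le_layerHeight hd
  have h2 : (m : ℝ) ≤ 2 * (((m / 2 : ℕ) : ℝ) + 1) := by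
    exact_mod_cast (by omega : m ≤ 2 * (m / 2 + 1))
  have h3 : ((d : ℝ) + 1) / d ≤ 4 / 3 := by
    rw [div_le_div_iff₀ (by linarith) (by norm_num)]; linarith
  push_cast at *
  calc 1 / 300 * ((m : ℝ) * (d + 1) * (Real.log (Real.log d) / d))
      = 1 / 300 * m * (((d : ℝ) + 1) / d) * Real.log (Real.log d) := by ring
    _ ≤ 1 / 300 * m * (((d : ℝ) + 1) / d) * (4 * layerHeight d) := by gcongr
    _ ≤ 1 / 300 * (2 * (((m / 2 : ℕ) : ℝ) + 1)) * (4 / 3) * (4 * layerHeight d) := by gcongr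
    _ ≤ _ := by
      have : 0 ≤ layerHeight d * (((m / 2 : ℕ) : ℝ) + 1) := by positivity
      linarith

end RingOfCliques

end ZeroForcing
theorem theorem2 :
    -- the upper bound, with an absolute constant
    (∃ C : ℝ, 0 < C ∧ ∀ (d : ℕ), 2 ≤ d →
      ∀ (V : Type*) [Fintype V] [DecidableEq V] (G : SimpleGraph V) [DecidableRel G.Adj],
        G.Connected → G.IsRegularOfDegree d →
          ZeroForcing.ept G ≤
            ENNReal.ofReal (C * ((Fintype.card V : ℝ) * (Real.log d / d)))) ∧
    -- its explicit form, with an absolute constant in the logarithmic error term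
    (∃ A : ℝ, 0 < A ∧ ∀ (d : ℕ), 3 ≤ d →
      ∀ (V : Type*) [Fintype V] [DecidableEq V] (G : SimpleGraph V) [DecidableRel G.Adj],
        G.Connected → G.IsRegularOfDegree d →
          ZeroForcing.ept G ≤
            ENNReal.ofReal (60 * (Real.log (((d : ℝ) + 1) / 3) / ((d : ℝ) + 1)) *
              (Fintype.card V : ℝ) + A * Real.log (Fintype.card V : ℝ))) ∧
    -- the lower bound for the rings of cliques, on `n = m (d + 1)` vertices
    (∃ c : ℝ, 0 < c ∧ ∀ (d : ℕ), 3 ≤ d → ∀ (m : ℕ) [NeZero m],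
      (ZeroForcing.ringOfCliques m d).Connected ∧
      (ZeroForcing.ringOfCliques m d).IsRegularOfDegree d ∧
      ENNReal.ofReal (c * (((m * (d + 1) : ℕ) : ℝ) * (Real.log (Real.log d) / d))) ≤
        ZeroForcing.ept (ZeroForcing.ringOfCliques m d)) := by
  refine ⟨⟨70, by norm_num, fun d hd V _ _ G _ hG hreg =>
      ZeroForcing.ept_le_const_mul G hG hd hreg⟩,
    ⟨13, by norm_num, fun d hd V _ _ G _ hG hreg => ZeroForcing.ept_le_explicit G hG hd hreg⟩,
    ⟨1 / 300, by norm_num, fun d hd m _ => ⟨ZeroForcing.ringOfCliques_connected (by omega),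
      ZeroForcing.ringOfCliques_isRegularOfDegree (by omega),
      ZeroForcing.le_ept_ringOfCliques hd⟩⟩⟩
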